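/- \textbf{Conventions.} An Ore domain is a domain satisfying the left and the right Ore condition; $\mathrm{Frac}\,A$ denotes its skew field of fractions and $Z(A)$ its centre. For a field $K$ let $A_n(K)$ be the $n$-th Weyl algebra over $K$ (generators $x_1,\dots,x_n,y_1,\dots,y_n$, relations $[x_i,x_j]=[y_i,y_j]=0$, $[y_i,x_j]=\delta_{ij}$), and for a field $k$ let $\mathbb D_{n,l}(k)$ be the skew field of fractions of $A_n(k(t_1,\dots,t_l))$. For a $k$-algebra $A$ let $$\mathrm{Tdeg}\,A=\sup_V\inf_b\limsup_{n\to\infty}\frac{\log\dim_k (k+bV)^n}{\log n}$$ be the Gelfand--Kirillov transcendence degree, where $V$ ranges over the finite-dimensional subspaces of $A$ and $b$ over the regular elements of $A$; $\mathrm{tdeg}$ is the usual transcendence degree over $k$. \textbf{Definition.} A family $\mathcal K=\{A_k\}$ of $k$-algebras, indexed by all algebraically closed fields $k$ (of any characteristic), is \emph{$\mathbb Z$-compatible} if: (1) there is a ring $A_{\mathbb Z}$ with $A_k=A_{\mathbb Z}\otimes_{\mathbb Z}k$ for all $k$; (2) $A_{\mathbb Z}$ and all $A_k$ are Ore domains;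 (3) there is a finitely generated $\mathbb Z$-submodule $V\subseteq A_{\mathbb Z}$ such that the modules $A_i^{\mathbb Z}=(\mathbb Z+V)^i$, $i\ge 0$ (so $A_0^{\mathbb Z}=\mathbb Z$ and $A_i^{\mathbb Z}=(A_1^{\mathbb Z})^i$), are free over $\mathbb Z$ and form an exhaustive filtration of $A_{\mathbb Z}$, and for every $k$ and $i$ the natural map $A_i^{\mathbb Z}\otimes_{\mathbb Z} k\to A_k$ is injective, so that the $A_i^k=A_i^{\mathbb Z}\otimes_{\mathbb Z} k$ are a finite-dimensional filtration of $A_k$; (4) $Z(\mathrm{Frac}\,A_k)\cong\mathrm{Frac}\,Z(A_k)$ as $k$-algebras if $\mathrm{char}\,k=0$; (5) $\mathrm{Tdeg}\,\mathrm{Frac}\,A_k=\dim_k (V\otimes_{\mathbb Z}k)$ for all $k$; (6) there are $x_1,\dots,x_s\in A_{\mathbb Z}$ such that, for every $k$ of characteristic $0$, $Z(A_k)$ is the polynomial algebra $k[x_1,\dots,x_s]$, and for every algebraically closed $\mathbb F$ of prime characteristic the images of the $x_i$ in $A_{\mathbb F}$ lie in $Z(A_{\mathbb F})$. For $k$ algebraically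 closed of characteristic $0$, the \emph{Gelfand--Kirillov Conjecture holds for $A_k$} if $\mathrm{Frac}\,A_k\cong\mathbb D_{n,l}(k)$ as $k$-algebras for some $n,l\ge 0$ with $\mathrm{Tdeg}\,\mathrm{Frac}\,A_k=2n+l$ and $l=\mathrm{tdeg}\,\mathrm{Frac}\,Z(A_k)$. \textbf{Theorem.} Let $\mathcal K=\{A_k\}$ be a $\mathbb Z$-compatible family of algebras. There is a first-order sentence $\phi_{\mathcal K}$ in the language of rings $(0,1,+,*)$, which is the existential closure of a boolean combination of atomic formulas, such that the following are equivalent: (1) for some algebraically closed field $k$ of characteristic $0$, the Gelfand--Kirillov Conjecture holds for $A_k$; (2) for every algebraically closed field $k$ of characteristic $0$, the Gelfand--Kirillov Conjecture holds for $A_k$; (3) $ACF_0\vdash\phi_{\mathcal K}$. -/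

import Mathlib

universe u v

open scoped TensorProduct

noncomputable section

namespace ZCompat

/-! ### Ore domains and their skew fields of fractions -/

/-- A (two-sided) Ore domain: a domain in which any two elements, one of them nonzero, have a
common left multiple and a common right multiple of the usual kind. -/
structure IsOreDomain (A : Type*) [Ring A] : Prop where
  isDomain : IsDomain A
  left : ∀ a b : A, b ≠ 0 → ∃ c d : A, d ≠ 0 ∧ d * a = c * b
  right : ∀ a b : A, b ≠ 0 → ∃ c d : A, d ≠ 0 ∧ a * d = b * c

/-- The nonzero elements of an Ore domain form an Ore set in the sense of Mathlib. -/
@[reducible]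
def IsOreDomain.oreSet {A : Type*} [Ring A] (h : IsOreDomain A) :
    OreLocalization.OreSet (nonZeroDivisors A) :=
  haveI := h.isDomain
  have key : ∀ (a : A) (s : nonZeroDivisors A), ∃ p : A × nonZeroDivisors A,
      (p.2 : A) * a = p.1 * (s : A) := fun a s => by
    obtain ⟨c, d, hd, e⟩ := h.left a s (nonZeroDivisors.coe_ne_zero s)
    exact ⟨(c, ⟨d, mem_nonZeroDivisors_of_ne_zero hd⟩), e⟩
  { ore_right_cancel := fun r₁ r₂ s hs =>
      ⟨1, by rw [mul_right_cancel₀ (nonZeroDivisors.coe_ne_zero s) hs]⟩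
    oreNum := fun a s => (key a s).choose.1
    oreDenom := fun a s => (key a s).choose.2
    ore_eq := fun a s => (key a s).choose_spec }

/-- `Frac A`, the skew field of fractions `b⁻¹ a` of an Ore domain `A`: the Ore localization of `A`
at its nonzero elements, with Mathlib's ring and algebra structures. -/
abbrev SkewFrac (A : Type*) [Ring A] (h : IsOreDomain A) : Type _ :=
  letI := h.oreSet
  OreLocalization (nonZeroDivisors A) A

/-- The ring `Frac A` is a division ring. -/
@[reducible]
def IsOreDomain.divisionRing {A : Type*} [Ring A] (h : IsOreDomain A) :
    DivisionRing (SkewFrac A h) :=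
  letI := h.oreSet
  haveI := h.isDomain
  inferInstance

/-- `f : R → D` exhibits the skew field `D` as a skew field of fractions of `R`: it is injective
and every element of `D` is a fraction `f(b)⁻¹ f(a)`. Such a `D` is unique up to isomorphism. -/
structure IsSkewFieldOfFractions {R D : Type*} [Ring R] [DivisionRing D] (f : R →+* D) :
    Prop where
  injective : Function.Injective f
  exists_fraction : ∀ d : D, ∃ a b : R, b ≠ 0 ∧ d = (f b)⁻¹ * f a

/-! ### Weyl algebras and Weyl fields -/

/-- The defining relations of the `n`-th Weyl algebra; `Sum.inl i` is the index of `x_i` and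
`Sum.inr i` that of `y_i`. -/
inductive WeylRel (K : Type*) [CommRing K] (n : ℕ) :
    FreeAlgebra K (Fin n ⊕ Fin n) → FreeAlgebra K (Fin n ⊕ Fin n) → Prop
  | xx (i j : Fin n) : WeylRel K n
      (FreeAlgebra.ι K (Sum.inl i) * FreeAlgebra.ι K (Sum.inl j) -
        FreeAlgebra.ι K (Sum.inl j) * FreeAlgebra.ι K (Sum.inl i)) 0
  | yy (i j : Fin n) : WeylRel K n
      (FreeAlgebra.ι K (Sum.inr i) * FreeAlgebra.ι K (Sum.inr j) -
        FreeAlgebra.ι K (Sum.inr j) * FreeAlgebra.ι K (Sum.inr i)) 0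
  | yx (i j : Fin n) : WeylRel K n
      (FreeAlgebra.ι K (Sum.inr i) * FreeAlgebra.ι K (Sum.inl j) -
        FreeAlgebra.ι K (Sum.inl j) * FreeAlgebra.ι K (Sum.inr i)) (if i = j then 1 else 0)

/-- The `n`-th Weyl algebra `A_n(K)`. -/
abbrev WeylAlgebra (K : Type*) [CommRing K] (n : ℕ) : Type _ := RingQuot (WeylRel K n)

/-- The field `k(t_1, …, t_l)` of rational functions. -/
abbrev RatFunField (k : Type*) [Field k] (l : ℕ) : Type _ := FractionRing (MvPolynomial (Fin l) k)

/-- The algebra `A_{n,l}(k) = A_n(k(t_1, …, t_l))`, which is regarded as a `k`-algebra. -/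
abbrev WeylAlgebraOver (k : Type*) [Field k] (n l : ℕ) : Type _ := WeylAlgebra (RatFunField k l) n

/-- `B ≅ 𝔻_{n,l}(k)` as `k`-algebras, where `𝔻_{n,l}(k)` is the skew field of fractions of
`A_{n,l}(k)`. -/
def IsoWeylField (k : Type u) [Field k] (n l : ℕ) (B : Type*) [Ring B] [Algebra k B] : Prop :=
  ∃ (D : Type u) (_ : DivisionRing D) (_ : Algebra k D) (f : WeylAlgebraOver k n l →ₐ[k] D),
    IsSkewFieldOfFractions (f : WeylAlgebraOver k n l →+* D) ∧ Nonempty (B ≃ₐ[k] D)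

/-! ### The Gelfand–Kirillov transcendence degree -/

/-- The growth exponent `limsup_n log (dim_k Wⁿ) / log n` of a finite-dimensional subspace `W`. -/
def growth (k : Type*) [Field k] {A : Type*} [Ring A] [Algebra k A] (W : Submodule k A) : EReal :=
  Filter.limsup (fun n : ℕ =>
    ((Real.log (Module.finrank k (W ^ n : Submodule k A)) / Real.log n : ℝ) : EReal)) Filter.atTop

/-- The Gelfand–Kirillov transcendence degree
`Tdeg A = sup_V inf_b limsup_n log (dim_k (k + bV)ⁿ) / log n`, with `V` ranging over the
finite-dimensional subspaces of `A` and `b` over its regular elements. -/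
def Tdeg (k : Type*) [Field k] (A : Type*) [Ring A] [Algebra k A] : EReal :=
  ⨆ (V : Submodule k A) (_ : FiniteDimensional k V), ⨅ (b : A) (_ : b ∈ nonZeroDivisors A),
    growth k (1 ⊔ V.map (LinearMap.mulLeft k b))

/-! ### `ℤ`-compatible families -/

/-- The filtration `A_0 = ℤ`, `A_i = A_1 ^ i` with `A_1 = ℤ + V`. It is increasing and
multiplicative. -/
def filtr {AZ : Type*} [Ring AZ] (V : Submodule ℤ AZ) (i : ℕ) : Submodule ℤ AZ := (1 ⊔ V) ^ i

/-- The ring `AZ` defines a `ℤ`-compatible family `A_k = k ⊗ AZ`, `k` running over all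
algebraically closed fields. The module `gens` is the degree-one generating module of the
filtration, and its rank is the number that the transcendence degree has to equal. It may or may
not contain `1`: the choice `gens = A_1` is allowed, and so is `gens = 𝔤` for `U(𝔤)` with
`A_1 = ℤ + 𝔤`. -/
structure ZCompatible (AZ : Type v) [Ring AZ] where
  /-- Ore conditions. -/
  oreDomain : ∀ (k : Type u) [Field k] [IsAlgClosed k], IsOreDomain (k ⊗[ℤ] AZ)
  oreDomain_int : IsOreDomain AZ
  /-- The filtration of `AZ`, which is exhaustive and by finitely generated free modules. -/
  gens : Submodule ℤ AZ
  gens_fg : gens.FG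
  exhaustive : ⨆ i, filtr gens i = ⊤
  filtr_free : ∀ i, Module.Free ℤ (filtr gens i)
  /-- `k ⊗ A_i` is a subspace of `A_k`. -/
  filtr_baseChange : ∀ (k : Type u) [Field k] [IsAlgClosed k] (i : ℕ),
    Function.Injective ((filtr gens i).subtype.baseChange k)
  /-- `Z(Frac A_k) ≅ Frac Z(A_k)` in characteristic zero. -/
  center_frac : ∀ (k : Type u) [Field k] [IsAlgClosed k] [CharZero k],
    Nonempty (Subalgebra.center k (SkewFrac (k ⊗[ℤ] AZ) (oreDomain k)) ≃ₐ[k]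
      FractionRing (Subalgebra.center k (k ⊗[ℤ] AZ)))
  /-- The transcendence degree of `Frac A_k`. -/
  tdeg_eq : ∀ (k : Type u) [Field k] [IsAlgClosed k],
    Tdeg k (SkewFrac (k ⊗[ℤ] AZ) (oreDomain k)) = (Module.finrank k (k ⊗[ℤ] gens) : EReal)
  /-- The centre is a polynomial algebra on elements `x_1, …, x_s` of `AZ`. -/
  s : ℕ
  x : Fin s → AZ
  center_poly : ∀ (k : Type u) [Field k] [IsAlgClosed k] [CharZero k],
    ∃ e : MvPolynomial (Fin s) k ≃ₐ[k] Subalgebra.center k (k ⊗[ℤ] AZ),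
      ∀ i, (e (MvPolynomial.X i) : k ⊗[ℤ] AZ) = 1 ⊗ₜ[ℤ] x i
  center_modular : ∀ (F : Type u) [Field F] [IsAlgClosed F] (p : ℕ), p.Prime → CharP F p →
    ∀ i, (1 ⊗ₜ[ℤ] x i : F ⊗[ℤ] AZ) ∈ Subalgebra.center F (F ⊗[ℤ] AZ)

/-- The Gelfand–Kirillov Conjecture holds for the Ore domain `A` over `k`: `Frac A ≅ 𝔻_{n,l}(k)`
where `Tdeg Frac A = 2n + l` and `l` is the transcendence degree of `Frac Z(A)` over `k`. -/
def GelfandKirillovHolds (k : Type u) [Field k] (A : Type*) [Ring A] [Algebra k A]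
    (h : IsOreDomain A) : Prop :=
  ∃ n l : ℕ, Tdeg k (SkewFrac A h) = ((2 * n + l : ℕ) : EReal) ∧
    Algebra.trdeg k (FractionRing (Subalgebra.center k A)) = (l : Cardinal) ∧
    IsoWeylField k n l (SkewFrac A h)

/-! ### The language `(0, 1, +, *)` -/

/-- The function symbols `0, 1, +, *`. -/
inductive ArithFunc : ℕ → Type
  | zero : ArithFunc 0
  | one : ArithFunc 0
  | add : ArithFunc 2
  | mul : ArithFunc 2

/-- The language `(0, 1, +, *)`. -/
def arithLang : FirstOrder.Language := ⟨ArithFunc, fun _ => Empty⟩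

/-- The inclusion of `(0, 1, +, *)` into Mathlib's language of rings, which also has a symbol for
negation and in which Mathlib states the theory of algebraically closed fields. -/
def arithToRing : arithLang.LHom FirstOrder.Language.ring where
  onFunction := fun _ f => match f with
    | .zero => FirstOrder.ringFunc.zero
    | .one => FirstOrder.ringFunc.one
    | .add => FirstOrder.ringFunc.add
    | .mul => FirstOrder.ringFunc.mul
  onRelation := fun _ r => Empty.elim r

end ZCompat

end

noncomputable section

namespace ZCompat

/-! ### Weyl families -/

/-! If the conjecture fails over every algebraically closed field of characteristic zero, `⊥` serves
as the sentence. Otherwise it holds over some `k`, and the isomorphism is encoded by finitely much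
data in `Frac A_k` (`exists_isWeylGenerating`): elements `X`, `Y`, `T` with the relations of
`A_n(k[t_1, …, t_l])`, an expression of each generator of `A_ℤ` as a left fraction in them, and an
algebraic equation over the `T_j` for each `x_i`. This data involves finitely many elements of `k`,
and its validity needs only finitely many sums, products and inequations `a ≠ 0` among them. The
sentence says that elements with these properties exist. It is true in `k`, hence in all
algebraically closed fields of characteristic zero by completeness of `ACF 0`.

The transfer to another field `k'` uses a mere map `k → k'`, since a field embedding need not exist.
Along the filter generated by the true basic formulas, such maps become a ring homomorphism on
germs. Nonzero elements of `A_k` become units there because bases of the layers of `A_ℤ` stay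
independent over every field (`isUnit_elementGerm`). The universal property of `Frac A_k` then
spreads out all fractions at once, with no bookkeeping of noncommutative denominators.

Over `k'` the spread-out data gives back an isomorphism (`isoWeylField`). Injectivity is automatic:
the Weyl algebra in characteristic zero is simple, and the `T_j` are independent because the `s = l`
independent elements `x_i` are algebraic over them. Surjectivity holds because the left fractions
form a division subalgebra, by an Ore condition coming from polynomial growth (`exists_left_ore`),
and contain the generators. The numbers `2n + l` and `l` do not change with the field, being the
rank of `gens` and `s`. -/

/-- Elements `X i`, `Y i` of a ring that satisfy the relations of the Weyl algebra. -/
structure IsWeylFamily {n : ℕ} {B : Type*} [Ring B] (X Y : Fin n → B) : Prop where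
  xx : ∀ i j, X i * X j = X j * X i
  yy : ∀ i j, Y i * Y j = Y j * Y i
  yx : ∀ i j, Y i * X j = X j * Y i + if i = j then 1 else 0

/-! ### The degree filtration of the algebra generated by a Weyl family. -/

section Filtration

variable (K : Type*) [Field K] {B : Type*} [Ring B] [Algebra K B] {n : ℕ} (X Y : Fin n → B)

/-- The span of `1` and the members of a Weyl family. -/
def weylSpan : Submodule K B := Submodule.span K (insert 1 (Set.range X ∪ Set.range Y))

variable {K X Y}

theorem one_mem_weylSpan : (1 : B) ∈ weylSpan K X Y :=
  Submodule.subset_span (Set.mem_insert _ _)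

theorem left_mem_weylSpan (i : Fin n) : X i ∈ weylSpan K X Y :=
  Submodule.subset_span (Or.inr (Or.inl ⟨i, rfl⟩))

theorem right_mem_weylSpan (i : Fin n) : Y i ∈ weylSpan K X Y :=
  Submodule.subset_span (Or.inr (Or.inr ⟨i, rfl⟩))

theorem weylSpan_pow_le_succ (N : ℕ) : weylSpan K X Y ^ N ≤ weylSpan K X Y ^ (N + 1) := by
  intro w hw
  rw [pow_succ']
  simpa using Submodule.mul_mem_mul (one_mem_weylSpan (X := X) (Y := Y)) hw

theorem weylSpan_pow_mono {N N' : ℕ} (h : N ≤ N') :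
    weylSpan K X Y ^ N ≤ weylSpan K X Y ^ N' :=
  monotone_nat_of_le_succ (f := fun N => weylSpan K X Y ^ N) weylSpan_pow_le_succ h

theorem mul_mem_weylSpan_pow_succ {g w : B} {N : ℕ} (hg : g ∈ weylSpan K X Y)
    (hw : w ∈ weylSpan K X Y ^ N) : g * w ∈ weylSpan K X Y ^ (N + 1) := by
  rw [pow_succ']; exact Submodule.mul_mem_mul hg hw

theorem mem_weylSpan_pow_zero {w : B} :
    w ∈ weylSpan K X Y ^ 0 ↔ ∃ c : K, algebraMap K B c = w := by
  rw [pow_zero, Submodule.mem_one]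

/-- To prove a linear statement on the `(N + 1)`-st layer it is enough to consider products of a
generator with an element of the `N`-th layer. -/
theorem weylSpan_pow_succ_le {N : ℕ} {P : Submodule K B}
    (h1 : ∀ w ∈ weylSpan K X Y ^ N, w ∈ P)
    (hX : ∀ i, ∀ w ∈ weylSpan K X Y ^ N, X i * w ∈ P)
    (hY : ∀ i, ∀ w ∈ weylSpan K X Y ^ N, Y i * w ∈ P) :
    weylSpan K X Y ^ (N + 1) ≤ P := by
  rw [pow_succ', Submodule.mul_le]
  intro g hg w hw
  induction hg using Submodule.span_induction with
  | mem g hg =>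
    rcases hg with rfl | ⟨i, rfl⟩ | ⟨i, rfl⟩
    · simpa using h1 w hw
    · exact hX i w hw
    · exact hY i w hw
  | zero => simp
  | add a b _ _ ha hb => rw [add_mul]; exact P.add_mem ha hb
  | smul c a _ ha => rw [smul_mul_assoc]; exact P.smul_mem c ha

/-! ### Commutators, the Euler operator and simplicity. -/

variable (K) in
/-- The commutator `w ↦ z * w - w * z`. -/
def commutator (z : B) : B →ₗ[K] B := LinearMap.mulLeft K z - LinearMap.mulRight K z

theorem commutator_apply (z w : B) : commutator K z w = z * w - w * z := rfl

theorem commutator_mul (z a b : B) :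
    commutator K z (a * b) = commutator K z a * b + a * commutator K z b := by
  simp only [commutator_apply]; noncomm_ring

theorem commutator_eq_zero_of_mem_pow_zero (z : B) {w : B} (hw : w ∈ weylSpan K X Y ^ 0) :
    commutator K z w = 0 := by
  obtain ⟨c, rfl⟩ := mem_weylSpan_pow_zero.1 hw
  rw [commutator_apply, Algebra.commutes, sub_self]

/-- A commutator that maps the generators to scalars lowers the filtration by one. -/
theorem commutator_mem {z : B} (hX : ∀ i, ∃ c : K, commutator K z (X i) = algebraMap K B c)
    (hY : ∀ i, ∃ c : K, commutator K z (Y i) = algebraMap K B c) (N : ℕ) {w : B}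
    (hw : w ∈ weylSpan K X Y ^ (N + 1)) : commutator K z w ∈ weylSpan K X Y ^ N := by
  induction N generalizing w with
  | zero =>
    refine weylSpan_pow_succ_le (P := (weylSpan K X Y ^ 0).comap (commutator K z)) ?_ ?_ ?_ hw
    · intro w hw
      rw [Submodule.mem_comap, commutator_eq_zero_of_mem_pow_zero z hw]
      exact zero_mem _
    · intro i w hw
      obtain ⟨c, hc⟩ := hX i
      rw [Submodule.mem_comap, commutator_mul, commutator_eq_zero_of_mem_pow_zero z hw, hc,
        ← Algebra.smul_def, mul_zero, add_zero]
      exact Submodule.smul_mem _ _ hw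
    · intro i w hw
      obtain ⟨c, hc⟩ := hY i
      rw [Submodule.mem_comap, commutator_mul, commutator_eq_zero_of_mem_pow_zero z hw, hc,
        ← Algebra.smul_def, mul_zero, add_zero]
      exact Submodule.smul_mem _ _ hw
  | succ N ih =>
    refine weylSpan_pow_succ_le
      (P := (weylSpan K X Y ^ (N + 1)).comap (commutator K z)) ?_ ?_ ?_ hw
    · intro w hw
      exact weylSpan_pow_le_succ _ (ih hw)
    · intro i w hw
      obtain ⟨c, hc⟩ := hX i
      rw [Submodule.mem_comap, commutator_mul, hc, ← Algebra.smul_def]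
      exact add_mem (Submodule.smul_mem _ _ hw)
        (mul_mem_weylSpan_pow_succ (left_mem_weylSpan i) (ih hw))
    · intro i w hw
      obtain ⟨c, hc⟩ := hY i
      rw [Submodule.mem_comap, commutator_mul, hc, ← Algebra.smul_def]
      exact add_mem (Submodule.smul_mem _ _ hw)
        (mul_mem_weylSpan_pow_succ (right_mem_weylSpan i) (ih hw))

namespace IsWeylFamily

variable (h : IsWeylFamily X Y)
include h

theorem commutator_X_X (i j : Fin n) : commutator K (X i) (X j) = 0 := by
  rw [commutator_apply, h.xx, sub_self]

theorem commutator_Y_Y (i j : Fin n) : commutator K (Y i) (Y j) = 0 := by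
  rw [commutator_apply, h.yy, sub_self]

theorem commutator_Y_X (i j : Fin n) :
    commutator K (Y i) (X j) = if i = j then 1 else 0 := by
  rw [commutator_apply, h.yx, add_sub_cancel_left]

theorem commutator_X_Y (i j : Fin n) :
    commutator K (X i) (Y j) = -if j = i then 1 else 0 := by
  rw [commutator_apply, h.yx, sub_add_cancel_left]

theorem commutator_X_mem (i : Fin n) {N : ℕ} {w : B} (hw : w ∈ weylSpan K X Y ^ (N + 1)) :
    commutator K (X i) w ∈ weylSpan K X Y ^ N :=
  commutator_mem (fun j => ⟨0, by rw [h.commutator_X_X, map_zero]⟩)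
    (fun j => ⟨-if j = i then 1 else 0, by
      rw [h.commutator_X_Y, map_neg]; split_ifs <;> simp⟩) N hw

theorem commutator_Y_mem (i : Fin n) {N : ℕ} {w : B} (hw : w ∈ weylSpan K X Y ^ (N + 1)) :
    commutator K (Y i) w ∈ weylSpan K X Y ^ N :=
  commutator_mem (fun j => ⟨if i = j then 1 else 0, by
      rw [h.commutator_Y_X]; split_ifs <;> simp⟩)
    (fun j => ⟨0, by rw [h.commutator_Y_Y, map_zero]⟩) N hw

end IsWeylFamily

variable (K X Y) in
/-- The analogue of the Euler operator. Modulo lower order terms it multiplies the `N`-th layer of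
the filtration by `N`. -/
def euler : B →ₗ[K] B :=
  ∑ i, (LinearMap.mulLeft K (X i) ∘ₗ commutator K (Y i) -
    LinearMap.mulRight K (Y i) ∘ₗ commutator K (X i))

theorem euler_apply (w : B) : euler K X Y w =
    ∑ i, (X i * commutator K (Y i) w - commutator K (X i) w * Y i) := by
  simp [euler]

namespace IsWeylFamily

variable (h : IsWeylFamily X Y)
include h

/-- Commutators are derivations and `X j` commutes with every `X i`, so it moves out without a
correction; the only extra term comes from `[Y j, X j] = 1`. -/
theorem euler_X_mul (j : Fin n) (w : B) :
    euler K X Y (X j * w) = X j * w + X j * euler K X Y w := by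
  have key : ∀ i, X i * commutator K (Y i) (X j * w) - commutator K (X i) (X j * w) * Y i =
      (if i = j then X j * w else 0) +
        X j * (X i * commutator K (Y i) w - commutator K (X i) w * Y i) := by
    intro i
    rw [commutator_mul, commutator_mul, h.commutator_X_X, h.commutator_Y_X, mul_add,
      ← mul_assoc (X i) (X j), h.xx i j]
    split_ifs with e
    · subst e; noncomm_ring
    · noncomm_ring
  simp_rw [euler_apply, key, Finset.sum_add_distrib, Finset.mul_sum]
  simp

/-- Here two corrections `-[Y j, w]` arise, one from moving `X j` past `Y j` and one from moving `w`
past `Y j`. Both have lower degree, which is all that is needed. -/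
theorem euler_Y_mul (j : Fin n) (w : B) :
    euler K X Y (Y j * w) =
      Y j * w + Y j * euler K X Y w - (2 : K) • commutator K (Y j) w := by
  have key : ∀ i, X i * commutator K (Y i) (Y j * w) - commutator K (X i) (Y j * w) * Y i =
      (if i = j then w * Y j - commutator K (Y j) w else 0) +
        Y j * (X i * commutator K (Y i) w - commutator K (X i) w * Y i) := by
    intro i
    have e1 : X i * Y j = Y j * X i - if j = i then 1 else 0 := by rw [h.yx]; abel
    rw [commutator_mul, commutator_mul, h.commutator_X_Y, h.commutator_Y_Y, zero_mul, zero_add,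
      ← mul_assoc (X i) (Y j), e1]
    split_ifs with e e' e'
    · subst e; noncomm_ring
    · exact absurd e.symm e'
    · exact absurd e'.symm e
    · noncomm_ring
  simp_rw [euler_apply, key, Finset.sum_add_distrib, Finset.mul_sum]
  simp only [Finset.sum_ite_eq', Finset.mem_univ, if_true, two_smul]
  rw [show w * Y j = Y j * w - commutator K (Y j) w by rw [commutator_apply]; abel]
  abel

theorem euler_sub_smul_mem (N : ℕ) {w : B} (hw : w ∈ weylSpan K X Y ^ (N + 1)) :
    euler K X Y w - ((N + 1 : ℕ) : K) • w ∈ weylSpan K X Y ^ N := by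
  -- `L` plays the role of the layer below the `N`-th one; for `N = 0` it is `⊥`.
  have main : ∀ (N : ℕ) (L : Submodule K B)
      (hL : ∀ w ∈ weylSpan K X Y ^ N, euler K X Y w - (N : K) • w ∈ L)
      (hL' : ∀ w ∈ weylSpan K X Y ^ N, ∀ i, commutator K (Y i) w ∈ L)
      (hX : ∀ i, ∀ w ∈ L, X i * w ∈ weylSpan K X Y ^ N)
      (hY : ∀ i, ∀ w ∈ L, Y i * w ∈ weylSpan K X Y ^ N)
      (hLN : L ≤ weylSpan K X Y ^ N),
      weylSpan K X Y ^ (N + 1) ≤ (weylSpan K X Y ^ N).comap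
        (euler K X Y - ((N + 1 : ℕ) : K) • LinearMap.id) := by
    intro N L hL hL' hX hY hLN
    refine weylSpan_pow_succ_le ?_ ?_ ?_
    · intro w hw
      have e : (euler K X Y - ((N + 1 : ℕ) : K) • LinearMap.id : B →ₗ[K] B) w =
          (euler K X Y w - (N : K) • w) - w := by
        simp [add_smul]; abel
      rw [Submodule.mem_comap, e]
      exact sub_mem (hLN (hL w hw)) hw
    · intro i w hw
      have e : (euler K X Y - ((N + 1 : ℕ) : K) • LinearMap.id : B →ₗ[K] B) (X i * w) =
          X i * (euler K X Y w - (N : K) • w) := by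
        simp only [LinearMap.sub_apply, LinearMap.smul_apply, LinearMap.id_apply, h.euler_X_mul]
        rw [Nat.cast_add, Nat.cast_one, add_smul, one_smul, mul_sub, mul_smul_comm]
        abel
      rw [Submodule.mem_comap, e]
      exact hX i _ (hL w hw)
    · intro i w hw
      have e : (euler K X Y - ((N + 1 : ℕ) : K) • LinearMap.id : B →ₗ[K] B) (Y i * w) =
          Y i * (euler K X Y w - (N : K) • w) - (2 : K) • commutator K (Y i) w := by
        simp only [LinearMap.sub_apply, LinearMap.smul_apply, LinearMap.id_apply, h.euler_Y_mul]
        rw [Nat.cast_add, Nat.cast_one, add_smul, one_smul, mul_sub, mul_smul_comm]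
        abel
      rw [Submodule.mem_comap, e]
      exact sub_mem (hY i _ (hL w hw)) (Submodule.smul_mem _ _ (hLN (hL' w hw i)))
  induction N generalizing w with
  | zero =>
    refine main 0 ⊥ ?_ ?_ ?_ ?_ bot_le hw
    · intro w hw
      simp [euler_apply, commutator_eq_zero_of_mem_pow_zero _ hw]
    · intro w hw i
      simp [commutator_eq_zero_of_mem_pow_zero _ hw]
    · intro i w hw
      rw [(Submodule.mem_bot K).1 hw, mul_zero]; exact zero_mem _
    · intro i w hw
      rw [(Submodule.mem_bot K).1 hw, mul_zero]; exact zero_mem _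
  | succ N ih =>
    exact main (N + 1) (weylSpan K X Y ^ N) (fun w hw => ih hw)
      (fun w hw i => h.commutator_Y_mem i hw)
      (fun i w hw => mul_mem_weylSpan_pow_succ (left_mem_weylSpan i) hw)
      (fun i w hw => mul_mem_weylSpan_pow_succ (right_mem_weylSpan i) hw)
      (weylSpan_pow_le_succ N) hw

/-- In characteristic zero a homomorphism to a nonzero algebra is injective on the algebra that a
Weyl family generates. -/
theorem eq_zero_of_map_eq_zero [CharZero K] {C : Type*} [Ring C] [Algebra K C] [Nontrivial C]
    (g : B →ₐ[K] C) (N : ℕ) {w : B} (hw : w ∈ weylSpan K X Y ^ N) (hg : g w = 0) : w = 0 := by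
  induction N generalizing w with
  | zero =>
    obtain ⟨c, rfl⟩ := mem_weylSpan_pow_zero.1 hw
    rw [AlgHom.commutes, FaithfulSMul.algebraMap_eq_zero_iff] at hg
    rw [hg, map_zero]
  | succ N ih =>
    -- The commutators of `w` with the generators lie one layer lower and are still killed by `g`,
    -- so they vanish by induction.
    have hX : ∀ i, commutator K (X i) w = 0 := fun i =>
      ih (h.commutator_X_mem i hw) (by simp [commutator_apply, hg])
    have hY : ∀ i, commutator K (Y i) w = 0 := fun i =>
      ih (h.commutator_Y_mem i hw) (by simp [commutator_apply, hg])
    have hE := h.euler_sub_smul_mem N hw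
    -- Now `(N + 1) • w` lies in the `N`-th layer, and characteristic zero allows division by `N +
    -- 1`.
    have hE0 : euler K X Y w = 0 := by simp [euler_apply, hX, hY]
    rw [hE0, zero_sub, Submodule.neg_mem_iff,
      Submodule.smul_mem_iff _ (Nat.cast_ne_zero.2 N.succ_ne_zero)] at hE
    exact ih hE hg

end IsWeylFamily

theorem exists_mem_weylSpan_pow {w : B}
    (hw : w ∈ Algebra.adjoin K (Set.range X ∪ Set.range Y)) :
    ∃ N, w ∈ weylSpan K X Y ^ N := by
  induction hw using Algebra.adjoin_induction with
  | mem w hw =>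
    exact ⟨1, by rw [pow_one]; exact Submodule.subset_span (Or.inr hw)⟩
  | algebraMap c => exact ⟨0, mem_weylSpan_pow_zero.2 ⟨c, rfl⟩⟩
  | add a b _ _ ha hb =>
    obtain ⟨N, hN⟩ := ha
    obtain ⟨N', hN'⟩ := hb
    exact ⟨N + N', add_mem (weylSpan_pow_mono (Nat.le_add_right _ _) hN)
      (weylSpan_pow_mono (Nat.le_add_left _ _) hN')⟩
  | mul a b _ _ ha hb =>
    obtain ⟨N, hN⟩ := ha
    obtain ⟨N', hN'⟩ := hb
    exact ⟨N + N', by rw [pow_add]; exact Submodule.mul_mem_mul hN hN'⟩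

theorem weylSpan_pow_le_adjoin (N : ℕ) :
    weylSpan K X Y ^ N ≤ Subalgebra.toSubmodule (Algebra.adjoin K (Set.range X ∪ Set.range Y)) := by
  induction N with
  | zero =>
    intro w hw
    obtain ⟨c, rfl⟩ := mem_weylSpan_pow_zero.1 hw
    exact Subalgebra.algebraMap_mem _ c
  | succ N ih =>
    refine weylSpan_pow_succ_le ih ?_ ?_
    · intro i w hw
      exact Subalgebra.mul_mem _ (Algebra.subset_adjoin (Or.inl ⟨i, rfl⟩)) (ih hw)
    · intro i w hw
      exact Subalgebra.mul_mem _ (Algebra.subset_adjoin (Or.inr ⟨i, rfl⟩)) (ih hw)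

/-! ### Growth -/

open scoped IsMulCommutative in
/-- A commuting family of elements of an algebra can be substituted into polynomials. -/
theorem exists_algHom_of_commute {σ : Type*} (X : σ → B) (hX : ∀ i j, X i * X j = X j * X i) :
    ∃ f : MvPolynomial σ K →ₐ[K] B, ∀ i, f (MvPolynomial.X i) = X i := by
  have : IsMulCommutative (Algebra.adjoin K (Set.range X)) :=
    Algebra.isMulCommutative_adjoin K (by rintro _ ⟨i, rfl⟩ _ ⟨j, rfl⟩; exact hX i j)
  let x : σ → Algebra.adjoin K (Set.range X) := fun i => ⟨X i, Algebra.subset_adjoin ⟨i, rfl⟩⟩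
  refine ⟨(Algebra.adjoin K (Set.range X)).val.comp (MvPolynomial.aeval x), fun i => ?_⟩
  rw [AlgHom.comp_apply, MvPolynomial.aeval_X]
  rfl

/-- The commutator with `Y i` is a derivation that agrees with the partial derivative on the
variables. The rule is used to bring products into normal order. -/
theorem IsWeylFamily.Y_mul_algHom (h : IsWeylFamily X Y) {f : MvPolynomial (Fin n) K →ₐ[K] B}
    (hf : ∀ i, f (MvPolynomial.X i) = X i) (i : Fin n) (p : MvPolynomial (Fin n) K) :
    Y i * f p = f p * Y i + f (MvPolynomial.pderiv i p) := by
  induction p using MvPolynomial.induction_on with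
  | C c =>
    rw [MvPolynomial.pderiv_C, map_zero, add_zero]
    change Y i * f (algebraMap K _ c) = f (algebraMap K _ c) * Y i
    rw [AlgHom.commutes, Algebra.commutes]
  | add p q hp hq => simp only [map_add, mul_add, add_mul, hp, hq]; abel
  | mul_X p j hp =>
    rw [map_mul, hf, ← mul_assoc, hp, add_mul, mul_assoc, h.yx, Derivation.leibniz,
      MvPolynomial.pderiv_X, map_add, smul_eq_mul, smul_eq_mul, map_mul, map_mul, hf, mul_add,
      ← mul_assoc]
    have e : X j * f (MvPolynomial.pderiv i p) = f (MvPolynomial.pderiv i p) * X j := by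
      rw [← hf, ← map_mul, mul_comm, map_mul]
    rw [e]
    by_cases hij : i = j
    · subst hij; simp; abel
    · rw [if_neg hij, Pi.single_eq_of_ne (Ne.symm hij)]; simp

/-- Normal ordering shows that the `N`-th layer is spanned by the products `x^a y^b` with all `2n`
exponents at most `N`. Only spanning is needed, so linear independence and the characteristic play
no role. -/
theorem IsWeylFamily.finrank_weylSpan_pow_le (h : IsWeylFamily X Y) (N : ℕ) :
    Module.Finite K (weylSpan K X Y ^ N : Submodule K B) ∧
      Module.finrank K (weylSpan K X Y ^ N : Submodule K B) ≤ (N + 1) ^ (n + n) := by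
  obtain ⟨f, hf⟩ := exists_algHom_of_commute (K := K) X h.xx
  obtain ⟨g, hg⟩ := exists_algHom_of_commute (K := K) Y h.yy
  let m : (Fin n →₀ ℕ) → (Fin n →₀ ℕ) → B := fun a b =>
    f (MvPolynomial.monomial a 1) * g (MvPolynomial.monomial b 1)
  let S : ℕ → Set B := fun N =>
    {w | ∃ a b : Fin n →₀ ℕ, (∀ i, a i ≤ N) ∧ (∀ i, b i ≤ N) ∧ w = m a b}
  have hS : ∀ {N N'}, N ≤ N' → S N ⊆ S N' := by
    rintro N N' hN _ ⟨a, b, ha, hb, rfl⟩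
    exact ⟨a, b, fun i => (ha i).trans hN, fun i => (hb i).trans hN, rfl⟩
  have single_le : ∀ (a : Fin n →₀ ℕ) (N : ℕ) (i : Fin n), (∀ j, a j ≤ N) →
      ∀ j, (Finsupp.single i 1 + a : Fin n →₀ ℕ) j ≤ N + 1 := by
    intro a N i ha j
    rw [Finsupp.add_apply, add_comm]
    refine add_le_add (ha j) ?_
    rw [Finsupp.single_apply]; split_ifs <;> omega
  have hle : ∀ N, weylSpan K X Y ^ N ≤ Submodule.span K (S N) := by
    intro N
    induction N with
    | zero =>
      intro w hw
      obtain ⟨c, rfl⟩ := mem_weylSpan_pow_zero.1 hw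
      rw [Algebra.algebraMap_eq_smul_one]
      refine Submodule.smul_mem _ _ (Submodule.subset_span ⟨0, 0, by simp, by simp, ?_⟩)
      change 1 = f 1 * g 1
      rw [map_one, map_one, mul_one]
    | succ N ih =>
      have lift : ∀ (z : B), (∀ w ∈ S N, z * w ∈ Submodule.span K (S (N + 1))) →
          ∀ w ∈ weylSpan K X Y ^ N, z * w ∈ Submodule.span K (S (N + 1)) := by
        intro z hz w hw
        have : Submodule.span K (S N) ≤
            (Submodule.span K (S (N + 1))).comap (LinearMap.mulLeft K z) :=
          Submodule.span_le.2 hz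
        exact this (ih hw)
      refine weylSpan_pow_succ_le
        (fun w hw => Submodule.span_mono (hS N.le_succ) (ih hw))
        (fun i => lift _ ?_) (fun i => lift _ ?_)
      · rintro _ ⟨a, b, ha, hb, rfl⟩
        refine Submodule.subset_span ⟨Finsupp.single i 1 + a, b, single_le a N i ha,
          fun j => (hb j).trans N.le_succ, ?_⟩
        simp only [m]
        rw [← mul_assoc, ← hf, ← map_mul, MvPolynomial.X, MvPolynomial.monomial_mul, one_mul]
      · rintro _ ⟨a, b, ha, hb, rfl⟩
        simp only [m]
        rw [← mul_assoc, h.Y_mul_algHom hf, add_mul, mul_assoc, ← hg, ← map_mul,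
          MvPolynomial.X, MvPolynomial.monomial_mul, one_mul, MvPolynomial.pderiv_monomial]
        refine add_mem (Submodule.subset_span ⟨a, Finsupp.single i 1 + b,
          fun j => (ha j).trans N.le_succ, single_le b N i hb, rfl⟩) ?_
        rw [one_mul, ← mul_one ((a i : K)), ← smul_eq_mul (a i : K), ← MvPolynomial.smul_monomial,
          map_smul, smul_mul_assoc]
        refine Submodule.smul_mem _ _ (Submodule.subset_span ⟨_, b, ?_,
          fun j => (hb j).trans N.le_succ, rfl⟩)
        intro j
        rw [Finsupp.tsub_apply]
        exact (Nat.sub_le _ _).trans ((ha j).trans N.le_succ)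
  let e : (Fin n → Fin (N + 1)) × (Fin n → Fin (N + 1)) → B := fun p =>
    m (Finsupp.equivFunOnFinite.symm fun i => (p.1 i : ℕ))
      (Finsupp.equivFunOnFinite.symm fun i => (p.2 i : ℕ))
  have hSe : S N ⊆ Set.range e := by
    rintro _ ⟨a, b, ha, hb, rfl⟩
    refine ⟨(fun i => ⟨a i, Nat.lt_succ_of_le (ha i)⟩, fun i => ⟨b i, Nat.lt_succ_of_le (hb i)⟩),
      ?_⟩
    exact congrArg₂ m (Finsupp.ext fun _ => rfl) (Finsupp.ext fun _ => rfl)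
  have hle' := (hle N).trans (Submodule.span_mono hSe)
  have : Module.Finite K (Submodule.span K (Set.range e)) :=
    Module.Finite.span_of_finite K (Set.finite_range e)
  refine ⟨Submodule.finiteDimensional_of_le hle', (Submodule.finrank_mono hle').trans ?_⟩
  refine (finrank_range_le_card e).trans ?_
  simp [pow_add]

end Filtration

/-! ### The Ore condition -/

/-- A polynomial does not dominate an exponential. -/
theorem exists_pow_lt_two_pow (M e : ℕ) : ∃ j : ℕ, (j * M + 1) ^ e < 2 ^ j := by
  have h := tendsto_pow_const_div_const_pow_of_one_lt e (show (1 : ℝ) < 2 by norm_num)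
  -- With this bound, `j ^ e / 2 ^ j` below it means `(j * (M + 1)) ^ e < 2 ^ j`.
  have hpos : (0 : ℝ) < 1 / ((M + 1 : ℝ) ^ e) := by positivity
  obtain ⟨j, hj, hj1⟩ := ((h.eventually (gt_mem_nhds hpos)).and
    (Filter.eventually_ge_atTop 1)).exists
  refine ⟨j, ?_⟩
  rw [div_lt_div_iff₀ (by positivity) (by positivity), one_mul, ← mul_pow] at hj
  have h2 : ((j * (M + 1)) ^ e : ℕ) < 2 ^ j := by exact_mod_cast hj
  refine lt_of_le_of_lt (Nat.pow_le_pow_left ?_ e) h2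
  -- `j * M + 1 ≤ j * (M + 1)` because `1 ≤ j`.
  rw [mul_add, mul_one]; omega

/-- In a domain, the algebra generated by a Weyl family satisfies the left Ore condition. -/
theorem IsWeylFamily.exists_left_ore {K : Type*} [Field K] {B : Type*} [Ring B] [IsDomain B]
    [Algebra K B] {n : ℕ} {X Y : Fin n → B} (h : IsWeylFamily X Y) {a b : B}
    (ha : a ∈ Algebra.adjoin K (Set.range X ∪ Set.range Y))
    (hb : b ∈ Algebra.adjoin K (Set.range X ∪ Set.range Y)) (hb0 : b ≠ 0) :
    ∃ c ∈ Algebra.adjoin K (Set.range X ∪ Set.range Y),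
      ∃ d ∈ Algebra.adjoin K (Set.range X ∪ Set.range Y), d ≠ 0 ∧ d * a = c * b := by
  by_contra hcon
  push Not at hcon
  obtain ⟨N₁, hN₁⟩ := exists_mem_weylSpan_pow ha
  obtain ⟨N₂, hN₂⟩ := exists_mem_weylSpan_pow hb
  set M := N₁ + N₂
  have haM : a ∈ weylSpan K X Y ^ M := weylSpan_pow_mono (Nat.le_add_right _ _) hN₁
  have hbM : b ∈ weylSpan K X Y ^ M := weylSpan_pow_mono (Nat.le_add_left _ _) hN₂
  have fin : ∀ N, Module.Finite K (weylSpan K X Y ^ N : Submodule K B) :=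
    fun N => (h.finrank_weylSpan_pow_le N).1
  -- Without a common left multiple, `(p, q) ↦ p a + q b` is injective on a layer. So the dimension
  -- doubles every `M` degrees, against the polynomial bound.
  have step : ∀ N, 2 * Module.finrank K (weylSpan K X Y ^ N : Submodule K B) ≤
      Module.finrank K (weylSpan K X Y ^ (N + M) : Submodule K B) := by
    intro N
    let W := weylSpan K X Y ^ N
    let F : (W × W) →ₗ[K] (weylSpan K X Y ^ (N + M) : Submodule K B) :=
      LinearMap.codRestrict _ (((LinearMap.mulRight K a).comp W.subtype).coprod
        ((LinearMap.mulRight K b).comp W.subtype)) (by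
          rintro ⟨p, q⟩
          rw [pow_add]
          exact add_mem (Submodule.mul_mem_mul p.2 haM) (Submodule.mul_mem_mul q.2 hbM))
    have hF : Function.Injective F := by
      rw [← LinearMap.ker_eq_bot, LinearMap.ker_eq_bot']
      rintro ⟨p, q⟩ hpq
      have e : (p : B) * a + q * b = 0 := congrArg Subtype.val hpq
      have hp : (p : B) = 0 := by
        by_contra hp
        refine hcon (-q) (neg_mem (weylSpan_pow_le_adjoin N q.2)) p
          (weylSpan_pow_le_adjoin N p.2) hp ?_
        rw [neg_mul]; exact eq_neg_of_add_eq_zero_left e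
      have hq : (q : B) = 0 := by
        rw [hp, zero_mul, zero_add] at e
        exact (mul_eq_zero.1 e).resolve_right hb0
      ext <;> assumption
    have := fin N
    have := fin (N + M)
    have := LinearMap.finrank_le_finrank_of_injective hF
    rwa [Module.finrank_prod, ← two_mul] at this
  have lower : ∀ j : ℕ, 2 ^ j ≤
      Module.finrank K (weylSpan K X Y ^ (j * M) : Submodule K B) := by
    intro j
    induction j with
    | zero =>
      have := fin (0 * M)
      have : (weylSpan K X Y ^ (0 * M)) ≠ ⊥ := by
        rw [zero_mul, Submodule.ne_bot_iff]
        exact ⟨1, mem_weylSpan_pow_zero.2 ⟨1, map_one _⟩, one_ne_zero⟩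
      rw [pow_zero, Nat.one_le_iff_ne_zero]
      rwa [Ne, Submodule.finrank_eq_zero]
    | succ j ih =>
      rw [pow_succ', add_mul, one_mul]
      exact (Nat.mul_le_mul_left 2 ih).trans (step _)
  obtain ⟨j, hj⟩ := exists_pow_lt_two_pow M (n + n)
  exact absurd ((lower j).trans (h.finrank_weylSpan_pow_le _).2) (not_le.2 hj)

/-! ### Germs of sections along a filter -/

section Germ

variable {ι : Type*} (l : Filter ι) (F : ι → Type*) [∀ i, Ring (F i)]

/-- Two sections are congruent if they agree eventually along the filter. -/
def germCon : RingCon (∀ i, F i) where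
  r f g := ∀ᶠ i in l, f i = g i
  iseqv :=
    ⟨fun _ => Filter.Eventually.of_forall fun _ => rfl, fun h => h.mono fun _ e => e.symm,
      fun h h' => (h.and h').mono fun _ e => e.1.trans e.2⟩
  add' h h' := (h.and h').mono fun _ e => congrArg₂ (· + ·) e.1 e.2
  mul' h h' := (h.and h').mono fun _ e => congrArg₂ (· * ·) e.1 e.2

/-- The ring of germs of sections. -/
def GermRing : Type _ := (germCon l F).Quotient

instance : Ring (GermRing l F) := inferInstanceAs (Ring (germCon l F).Quotient)

variable {F}

/-- The germ of a section. -/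
def germ : (∀ i, F i) →+* GermRing l F := (germCon l F).mk'

variable {l}

theorem germ_eq_germ_iff {f g : ∀ i, F i} : germ l f = germ l g ↔ ∀ᶠ i in l, f i = g i :=
  RingCon.eq (germCon l F)

theorem germ_surjective : Function.Surjective (germ l : (∀ i, F i) →+* GermRing l F) :=
  RingCon.mk'_surjective (germCon l F)

end Germ

theorem isUnit_germ {ι : Type*} {l : Filter ι} {F : ι → Type*} [∀ i, DivisionRing (F i)]
    {f : ∀ i, F i} (h : ∀ᶠ i in l, f i ≠ 0) : IsUnit (germ l f) := by
  refine ⟨⟨germ l f, germ l fun i => (f i)⁻¹, ?_, ?_⟩, rfl⟩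
  · rw [← map_mul, ← map_one (germ l), germ_eq_germ_iff]
    exact h.mono fun i hi => mul_inv_cancel₀ hi
  · rw [← map_mul, ← map_one (germ l), germ_eq_germ_iff]
    exact h.mono fun i hi => inv_mul_cancel₀ hi

/-! ### The diagram of a field -/

/-- The basic formulas with parameters in `k`: `1 = 1`, `a + b = c`, `a * b = c` and `a ≠ 0`. -/
inductive Literal (k : Type u) : Type u
  | one : Literal k
  | add (a b : k) : Literal k
  | mul (a b : k) : Literal k
  | ne (a : k) : Literal k

/-- The interpretation of a basic formula with the parameters replaced along `c`. -/
def Literal.Holds {k : Type u} [Field k] {k' : Type*} [Field k'] (c : k → k') : Literal k → Prop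
  | .one => c 1 = 1
  | .add a b => c (a + b) = c a + c b
  | .mul a b => c (a * b) = c a * c b
  | .ne a => c a ≠ 0

/-- An algebraically closed field of characteristic zero together with a map from `k`, which is
not assumed to respect the operations. -/
structure Point (k : Type u) : Type (u + 1) where
  carrier : Type u
  [field : Field carrier]
  [isAlgClosed : IsAlgClosed carrier]
  [charZero : CharZero carrier]
  map : k → carrier

attribute [instance] Point.field Point.isAlgClosed Point.charZero

/-- The filter on the points generated by the finite pieces of the diagram of `k`. -/
def diagramFilter (k : Type u) [Field k] : Filter (Point k) :=
  Filter.generate {s | ∃ L : Literal k, L.Holds (id : k → k) ∧ s = {p | L.Holds p.map}}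

section Diagram

variable {k : Type u} [Field k]

theorem eventually_holds {L : Literal k} (h : L.Holds (id : k → k)) :
    ∀ᶠ p in diagramFilter k, L.Holds p.map :=
  Filter.mem_generate_of_mem ⟨L, h, rfl⟩

theorem eventually_map_one : ∀ᶠ p in diagramFilter k, p.map 1 = 1 :=
  eventually_holds (L := .one) rfl

theorem eventually_map_add (a b : k) :
    ∀ᶠ p in diagramFilter k, p.map (a + b) = p.map a + p.map b :=
  eventually_holds (L := .add a b) rfl

theorem eventually_map_mul (a b : k) :
    ∀ᶠ p in diagramFilter k, p.map (a * b) = p.map a * p.map b :=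
  eventually_holds (L := .mul a b) rfl

theorem eventually_map_ne_zero {a : k} (ha : a ≠ 0) : ∀ᶠ p in diagramFilter k, p.map a ≠ 0 :=
  eventually_holds (L := .ne a) ha

theorem eventually_map_zero : ∀ᶠ p in diagramFilter k, p.map 0 = 0 := by
  filter_upwards [eventually_map_add (0 : k) 0] with p hp
  simpa using hp

/-- What holds eventually is implied by finitely many basic formulas that are true in `k`. -/
theorem exists_literals_of_eventually {P : Point k → Prop}
    (h : ∀ᶠ p in diagramFilter k, P p) :
    ∃ S : Set (Literal k), S.Finite ∧ (∀ L ∈ S, L.Holds (id : k → k)) ∧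
      ∀ p : Point k, (∀ L ∈ S, L.Holds p.map) → P p := by
  obtain ⟨t, ht, htf, hP⟩ := Filter.mem_generate_iff.1 h
  have ht' : ∀ s : Set (Point k), ∃ L : Literal k,
      s ∈ t → L.Holds (id : k → k) ∧ s = {p | L.Holds p.map} := by
    intro s
    by_cases hs : s ∈ t
    · exact (ht hs).imp fun _ h _ => h
    -- A dummy value for the sets outside `t`.
    · exact ⟨.one, fun h => absurd h hs⟩
  choose L hL using ht'
  refine ⟨L '' t, Set.Finite.image _ htf, ?_, fun p hp => hP ?_⟩
  · rintro _ ⟨s, hs, rfl⟩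
    exact (hL s hs).1
  · intro s hs
    rw [(hL s hs).2]
    exact hp _ ⟨s, hs, rfl⟩

end Diagram

/-! ### Spreading out fractions -/

/-- The inclusion of an Ore domain into its skew field of fractions. -/
def toSkewFrac {A : Type*} [Ring A] (h : IsOreDomain A) : A →+* SkewFrac A h :=
  letI := h.oreSet
  OreLocalization.numeratorRingHom

theorem toSkewFrac_injective {A : Type*} [Ring A] (h : IsOreDomain A) :
    Function.Injective (toSkewFrac h) := by
  let _ := h.oreSet
  have := h.isDomain
  exact OreLocalization.numeratorHom_inj fun _ hx => hx.1

theorem toSkewFrac_algebraMap {k A : Type*} [CommRing k] [Ring A] [Algebra k A]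
    (h : IsOreDomain A) (c : k) :
    toSkewFrac h (algebraMap k A c) = algebraMap k (SkewFrac A h) c := rfl

theorem exists_fraction {A : Type*} [Ring A] (h : IsOreDomain A) (d : SkewFrac A h) :
    ∃ a b : A, b ≠ 0 ∧ toSkewFrac h b * d = toSkewFrac h a := by
  let _ := h.oreSet
  have := h.isDomain
  induction d using OreLocalization.ind with
  | _ r s =>
    refine ⟨r, s, nonZeroDivisors.coe_ne_zero s, ?_⟩
    exact OreLocalization.mul_cancel

/-- A ring homomorphism that maps the nonzero elements to units extends to the skew field of
fractions. -/
theorem exists_lift_skewFrac {A : Type*} [Ring A] (h : IsOreDomain A) {R : Type*} [Ring R]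
    (f : A →+* R) (hf : ∀ a, a ≠ 0 → IsUnit (f a)) :
    ∃ g : SkewFrac A h →+* R, ∀ a, g (toSkewFrac h a) = f a := by
  let _ := h.oreSet
  have := h.isDomain
  choose w hw using fun s : nonZeroDivisors A => hf s (nonZeroDivisors.coe_ne_zero s)
  let fS : nonZeroDivisors A →* Rˣ :=
    { toFun := w
      map_one' := Units.ext (by rw [hw]; simp)
      map_mul' := fun a b => Units.ext (by rw [Units.val_mul, hw, hw, hw]; simp) }
  exact ⟨OreLocalization.universalHom f fS fun s => (hw s).symm,
    fun a => OreLocalization.universalHom_commutes f fS _⟩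

section Spread

variable {AZ : Type v} [Ring AZ] (Z : ZCompatible.{u, v} AZ)

/-- The skew field of fractions of `A_k`. -/
def ZCompatible.Fraction (k : Type u) [Field k] [IsAlgClosed k] : Type _ :=
  SkewFrac (k ⊗[ℤ] AZ) (Z.oreDomain k)

instance (k : Type u) [Field k] [IsAlgClosed k] : DivisionRing (Z.Fraction k) :=
  (Z.oreDomain k).divisionRing

instance (k : Type u) [Field k] [IsAlgClosed k] : Algebra k (Z.Fraction k) :=
  inferInstanceAs (Algebra k (SkewFrac (k ⊗[ℤ] AZ) (Z.oreDomain k)))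

/-- `Z.Fraction k` is the skew field `Frac A_k`. -/
def ZCompatible.fractionEquiv (k : Type u) [Field k] [IsAlgClosed k] :
    SkewFrac (k ⊗[ℤ] AZ) (Z.oreDomain k) ≃ₐ[k] Z.Fraction k :=
  AlgEquiv.refl

/-- The inclusion of `A_k` into its skew field of fractions. -/
def ZCompatible.incl (k : Type u) [Field k] [IsAlgClosed k] : k ⊗[ℤ] AZ →ₐ[k] Z.Fraction k :=
  { toSkewFrac (Z.oreDomain k) with commutes' := fun c => toSkewFrac_algebraMap _ c }

theorem ZCompatible.incl_injective (k : Type u) [Field k] [IsAlgClosed k] :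
    Function.Injective (Z.incl k) :=
  toSkewFrac_injective (Z.oreDomain k)

theorem ZCompatible.exists_fraction (k : Type u) [Field k] [IsAlgClosed k] (d : Z.Fraction k) :
    ∃ a b : k ⊗[ℤ] AZ, b ≠ 0 ∧ Z.incl k b * d = Z.incl k a :=
  ZCompat.exists_fraction (Z.oreDomain k) d

/-- The map from `A_ℤ` to the skew field of fractions of `A_k`. -/
def ZCompatible.toFraction (k : Type u) [Field k] [IsAlgClosed k] : AZ →+* Z.Fraction k :=
  (Z.incl k).toRingHom.comp
    (Algebra.TensorProduct.includeRight : AZ →ₐ[ℤ] k ⊗[ℤ] AZ).toRingHom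

theorem ZCompatible.toFraction_apply (k : Type u) [Field k] [IsAlgClosed k] (a : AZ) :
    Z.toFraction k a = Z.incl k (1 ⊗ₜ a) := rfl

theorem ZCompatible.incl_tmul (k : Type u) [Field k] [IsAlgClosed k] (c : k) (a : AZ) :
    Z.incl k (c ⊗ₜ a) = algebraMap k _ c * Z.toFraction k a := by
  have : c ⊗ₜ[ℤ] a = algebraMap k (k ⊗[ℤ] AZ) c * (1 ⊗ₜ a) := by
    simp [Algebra.TensorProduct.algebraMap_apply]
  rw [this, map_mul, AlgHom.commutes, Z.toFraction_apply]

theorem ZCompatible.filtr_mono : Monotone (filtr Z.gens) := by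
  refine monotone_nat_of_le_succ fun i w hw => ?_
  rw [filtr, pow_succ', ← one_mul w]
  exact Submodule.mul_mem_mul (Submodule.one_le.1 le_sup_left) hw

theorem ZCompatible.exists_mem_filtr (a : AZ) : ∃ i, a ∈ filtr Z.gens i := by
  have : a ∈ ⨆ i, filtr Z.gens i := by rw [Z.exhaustive]; trivial
  rwa [Submodule.mem_iSup_of_directed _ Z.filtr_mono.directed_le] at this

/-- A tensor involves finitely many elements of `A_ℤ`, and these lie in a common layer. -/
theorem ZCompatible.exists_baseChange_eq (k : Type u) [Field k] (w : k ⊗[ℤ] AZ) :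
    ∃ i, ∃ w' : k ⊗[ℤ] filtr Z.gens i, (filtr Z.gens i).subtype.baseChange k w' = w := by
  have mono : ∀ {i j} (_ : i ≤ j) (w' : k ⊗[ℤ] filtr Z.gens i), ∃ w'' : k ⊗[ℤ] filtr Z.gens j,
      (filtr Z.gens j).subtype.baseChange k w'' = (filtr Z.gens i).subtype.baseChange k w' := by
    intro i j hij w'
    refine ⟨(Submodule.inclusion (Z.filtr_mono hij)).baseChange k w', ?_⟩
    rw [← LinearMap.comp_apply, ← LinearMap.baseChange_comp]
    rfl
  induction w using TensorProduct.induction_on with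
  | zero => exact ⟨0, 0, map_zero _⟩
  | tmul c a =>
    obtain ⟨i, hi⟩ := Z.exists_mem_filtr a
    exact ⟨i, c ⊗ₜ ⟨a, hi⟩, rfl⟩
  | add a b ha hb =>
    obtain ⟨i, a', rfl⟩ := ha
    obtain ⟨j, b', rfl⟩ := hb
    obtain ⟨a'', ha''⟩ := mono (le_max_left i j) a'
    obtain ⟨b'', hb''⟩ := mono (le_max_right i j) b'
    exact ⟨max i j, a'' + b'', by rw [map_add, ha'', hb'']⟩

include Z in
/-- Every element of `A_k` is a combination of elements of `A_ℤ` that stay linearly independent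
over all fields. -/
theorem ZCompatible.exists_eq_sum_tmul (k : Type u) [Field k] (w : k ⊗[ℤ] AZ) :
    ∃ (J : Type v) (s : Finset J) (b : J → AZ) (c : J → k), w = ∑ j ∈ s, c j ⊗ₜ b j ∧
      ∀ (k' : Type u) [Field k'] [IsAlgClosed k'] (c' : J → k'),
        ∑ j ∈ s, c' j ⊗ₜ[ℤ] b j = 0 → ∀ j ∈ s, c' j = 0 := by
  obtain ⟨i, w', rfl⟩ := Z.exists_baseChange_eq k w
  have := Z.filtr_free i
  -- A `ℤ`-basis of the layer becomes a basis after base change to `k'`, and `filtr_baseChange`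
  -- keeps it independent inside `A_{k'}`.
  let b := Module.Free.chooseBasis ℤ (filtr Z.gens i)
  let B := b.baseChange k
  refine ⟨_, (B.repr w').support, fun j => (b j : AZ), B.repr w', ?_, ?_⟩
  · conv_lhs => rw [← B.linearCombination_repr w', Finsupp.linearCombination_apply, Finsupp.sum,
      map_sum]
    refine Finset.sum_congr rfl fun j _ => ?_
    rw [map_smul, Module.Basis.baseChange_apply, LinearMap.baseChange_tmul,
      TensorProduct.smul_tmul', smul_eq_mul, mul_one]
    rfl
  · intro k' _ _ c' h j hj
    have h0 : (filtr Z.gens i).subtype.baseChange k'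
        (∑ j ∈ (B.repr w').support, c' j • b.baseChange k' j) = 0 := by
      rw [← h, map_sum]
      refine Finset.sum_congr rfl fun j _ => ?_
      rw [map_smul, Module.Basis.baseChange_apply, LinearMap.baseChange_tmul,
        TensorProduct.smul_tmul', smul_eq_mul, mul_one]
      rfl
    rw [← map_zero ((filtr Z.gens i).subtype.baseChange k')] at h0
    exact linearIndependent_iff'.1 (b.baseChange k').linearIndependent _ _
      (Z.filtr_baseChange k' i h0) j hj

variable (k : Type u) [Field k] [IsAlgClosed k]

/-- The ring of germs of families of fractions. -/
abbrev ZCompatible.FractionGerm : Type _ :=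
  GermRing (diagramFilter k) fun p : Point k => Z.Fraction p.carrier

/-- Scalars of `k`, viewed as germs of constant fractions. -/
def ZCompatible.scalarGerm : k →+* Z.FractionGerm k where
  toFun a := germ _ fun p => algebraMap p.carrier _ (p.map a)
  map_one' := by
    rw [← map_one (germ _), germ_eq_germ_iff]
    filter_upwards [eventually_map_one (k := k)] with p hp
    rw [hp, map_one, Pi.one_apply]
  map_zero' := by
    rw [← map_zero (germ _), germ_eq_germ_iff]
    filter_upwards [eventually_map_zero (k := k)] with p hp
    rw [hp, map_zero, Pi.zero_apply]
  map_add' a b := by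
    rw [← map_add (germ _), germ_eq_germ_iff]
    filter_upwards [eventually_map_add a b] with p hp
    rw [hp, map_add, Pi.add_apply]
  map_mul' a b := by
    rw [← map_mul (germ _), germ_eq_germ_iff]
    filter_upwards [eventually_map_mul a b] with p hp
    rw [hp, map_mul, Pi.mul_apply]

/-- Elements of `A_ℤ`, viewed as germs of fractions. -/
def ZCompatible.integralGerm : AZ →+* Z.FractionGerm k :=
  (germ _).comp (RingHom.pi fun p : Point k => Z.toFraction p.carrier)

/-- Elements of `A_k`, viewed as germs of fractions. -/
def ZCompatible.elementGerm : k ⊗[ℤ] AZ →+* Z.FractionGerm k :=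
  (Algebra.TensorProduct.lift (Z.scalarGerm k).toIntAlgHom (Z.integralGerm k).toIntAlgHom (by
    intro c a
    change germ _ _ * germ _ _ = germ _ _ * germ _ _
    rw [← map_mul, ← map_mul, germ_eq_germ_iff]
    exact Filter.Eventually.of_forall fun p =>
      Algebra.commutes (p.map c) (Z.toFraction p.carrier a))).toRingHom

variable {k}

omit [IsAlgClosed k] in
theorem ZCompatible.elementGerm_tmul (c : k) (a : AZ) :
    Z.elementGerm k (c ⊗ₜ a) =
      germ _ fun p : Point k => Z.incl p.carrier (p.map c ⊗ₜ a) := by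
  have : Z.elementGerm k (c ⊗ₜ a) = Z.scalarGerm k c * Z.integralGerm k a :=
    Algebra.TensorProduct.lift_tmul _ _ _ c a
  rw [this]
  simp_rw [Z.incl_tmul]
  rfl

-- Some coefficient of `w` with respect to integral basis elements is nonzero, and it remains
-- nonzero at almost all points. The basis elements remain independent there, so the value is a
-- nonzero element of `A_{k'}` and is invertible in its skew field.
omit [IsAlgClosed k] in
theorem ZCompatible.isUnit_elementGerm {w : k ⊗[ℤ] AZ} (hw : w ≠ 0) :
    IsUnit (Z.elementGerm k w) := by
  obtain ⟨J, s, b, c, rfl, hind⟩ := Z.exists_eq_sum_tmul k w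
  obtain ⟨j, hj, hcj⟩ : ∃ j ∈ s, c j ≠ 0 := by
    by_contra! hc
    exact hw (Finset.sum_eq_zero fun j hj => by rw [hc j hj, TensorProduct.zero_tmul])
  have e : Z.elementGerm k (∑ j ∈ s, c j ⊗ₜ b j) = germ _ fun p : Point k =>
      Z.incl p.carrier (∑ j ∈ s, p.map (c j) ⊗ₜ b j) := by
    rw [map_sum]
    simp_rw [Z.elementGerm_tmul]
    rw [← map_sum]
    congr 1
    ext p
    rw [Finset.sum_apply, map_sum]
  rw [e]
  refine isUnit_germ ?_
  filter_upwards [eventually_map_ne_zero hcj] with p hp h0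
  rw [map_eq_zero_iff _ (Z.incl_injective _)] at h0
  exact hp (hind p.carrier (fun j => p.map (c j)) h0 j hj)

variable (k) in
theorem ZCompatible.exists_fractionGerm : ∃ θ : Z.Fraction k →+* Z.FractionGerm k,
    ∀ w, θ (Z.incl k w) = Z.elementGerm k w :=
  exists_lift_skewFrac (Z.oreDomain k) (Z.elementGerm k) fun _ => Z.isUnit_elementGerm

variable (k) in
/-- The germ of the family of fractions defined by a fraction over `k`. -/
def ZCompatible.fractionGerm : Z.Fraction k →+* Z.FractionGerm k :=
  (Z.exists_fractionGerm k).choose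

theorem ZCompatible.fractionGerm_incl (w : k ⊗[ℤ] AZ) :
    Z.fractionGerm k (Z.incl k w) = Z.elementGerm k w :=
  (Z.exists_fractionGerm k).choose_spec w

/-- A family of fractions that represents the germ of `x`. -/
def ZCompatible.spread (x : Z.Fraction k) (p : Point k) : Z.Fraction p.carrier :=
  Function.surjInv germ_surjective (Z.fractionGerm k x) p

theorem ZCompatible.germ_spread (x : Z.Fraction k) :
    germ _ (Z.spread x) = Z.fractionGerm k x :=
  Function.surjInv_eq germ_surjective (Z.fractionGerm k x)

/-- Representatives of germs are chosen arbitrarily, so `spread` respects the operations only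
eventually, on a set of points that depends on the elements. -/
theorem ZCompatible.spread_add (x y : Z.Fraction k) :
    ∀ᶠ p in diagramFilter k, Z.spread (x + y) p = Z.spread x p + Z.spread y p := by
  change ∀ᶠ p in diagramFilter k, Z.spread (x + y) p = (Z.spread x + Z.spread y) p
  rw [← germ_eq_germ_iff, map_add, Z.germ_spread, Z.germ_spread, Z.germ_spread, map_add]

theorem ZCompatible.spread_mul (x y : Z.Fraction k) :
    ∀ᶠ p in diagramFilter k, Z.spread (x * y) p = Z.spread x p * Z.spread y p := by
  change ∀ᶠ p in diagramFilter k, Z.spread (x * y) p = (Z.spread x * Z.spread y) p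
  rw [← germ_eq_germ_iff, map_mul, Z.germ_spread, Z.germ_spread, Z.germ_spread, map_mul]

theorem ZCompatible.spread_zero :
    ∀ᶠ p in diagramFilter k, Z.spread (0 : Z.Fraction k) p = 0 := by
  change ∀ᶠ p in diagramFilter k, Z.spread (0 : Z.Fraction k) p =
    (0 : ∀ p : Point k, Z.Fraction p.carrier) p
  rw [← germ_eq_germ_iff, Z.germ_spread, map_zero, map_zero]

theorem ZCompatible.spread_one :
    ∀ᶠ p in diagramFilter k, Z.spread (1 : Z.Fraction k) p = 1 := by
  change ∀ᶠ p in diagramFilter k, Z.spread (1 : Z.Fraction k) p =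
    (1 : ∀ p : Point k, Z.Fraction p.carrier) p
  rw [← germ_eq_germ_iff, Z.germ_spread, map_one, map_one]

/-- The identity `x * x⁻¹ = 1` spreads out. -/
theorem ZCompatible.spread_ne_zero {x : Z.Fraction k} (hx : x ≠ 0) :
    ∀ᶠ p in diagramFilter k, Z.spread x p ≠ 0 := by
  filter_upwards [Z.spread_mul x x⁻¹, Z.spread_one (k := k)] with p hp hp1 h0
  rw [mul_inv_cancel₀ hx, hp1, h0, zero_mul] at hp
  exact one_ne_zero hp

theorem ZCompatible.spread_algebraMap (a : k) : ∀ᶠ p in diagramFilter k,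
    Z.spread (algebraMap k (Z.Fraction k) a) p = algebraMap p.carrier _ (p.map a) := by
  rw [← germ_eq_germ_iff, Z.germ_spread, ← AlgHom.commutes (Z.incl k), Z.fractionGerm_incl,
    Algebra.TensorProduct.algebraMap_apply, Z.elementGerm_tmul]
  simp_rw [Z.incl_tmul, map_one, mul_one]
  rfl

theorem ZCompatible.spread_toFraction (a : AZ) : ∀ᶠ p in diagramFilter k,
    Z.spread (Z.toFraction k a) p = Z.toFraction p.carrier a := by
  change ∀ᶠ p in diagramFilter k, Z.spread (Z.incl k (1 ⊗ₜ a)) p =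
    Z.incl p.carrier (1 ⊗ₜ a)
  have h : ∀ᶠ p in diagramFilter k, Z.spread (Z.incl k (1 ⊗ₜ a)) p =
      Z.incl p.carrier (p.map 1 ⊗ₜ a) := by
    rw [← germ_eq_germ_iff, Z.germ_spread, Z.fractionGerm_incl, Z.elementGerm_tmul]
  filter_upwards [h, eventually_map_one (k := k)] with p hp hp1
  rw [hp, hp1]

theorem ZCompatible.spread_mem_adjoin {S : Set (Z.Fraction k)} {x : Z.Fraction k}
    (hx : x ∈ Algebra.adjoin k S) : ∀ᶠ p in diagramFilter k,
      Z.spread x p ∈ Algebra.adjoin p.carrier ((fun y => Z.spread y p) '' S) := by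
  induction hx using Algebra.adjoin_induction with
  | mem x hx => exact Filter.Eventually.of_forall fun p => Algebra.subset_adjoin ⟨x, hx, rfl⟩
  | algebraMap c =>
    filter_upwards [Z.spread_algebraMap c] with p hp
    rw [hp]
    exact Subalgebra.algebraMap_mem _ _
  | add x y _ _ hx hy =>
    filter_upwards [Z.spread_add x y, hx, hy] with p hp h1 h2
    rw [hp]
    exact add_mem h1 h2
  | mul x y _ _ hx hy =>
    filter_upwards [Z.spread_mul x y, hx, hy] with p hp h1 h2
    rw [hp]
    exact mul_mem h1 h2

end Spread

/-! ### The Weyl algebra -/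

section WeylAlgebra

variable (K : Type*) [Field K] (n : ℕ)

/-- The generator `x_i` of the Weyl algebra. -/
def weylX (i : Fin n) : WeylAlgebra K n :=
  RingQuot.mkAlgHom K (WeylRel K n) (FreeAlgebra.ι K (Sum.inl i))

/-- The generator `y_i` of the Weyl algebra. -/
def weylY (i : Fin n) : WeylAlgebra K n :=
  RingQuot.mkAlgHom K (WeylRel K n) (FreeAlgebra.ι K (Sum.inr i))

theorem isWeylFamily_weyl : IsWeylFamily (weylX K n) (weylY K n) where
  xx i j := by
    have := RingQuot.mkAlgHom_rel K (WeylRel.xx (K := K) i j)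
    rwa [map_sub, map_mul, map_mul, map_zero, sub_eq_zero] at this
  yy i j := by
    have := RingQuot.mkAlgHom_rel K (WeylRel.yy (K := K) i j)
    rwa [map_sub, map_mul, map_mul, map_zero, sub_eq_zero] at this
  yx i j := by
    have := RingQuot.mkAlgHom_rel K (WeylRel.yx (K := K) i j)
    rw [map_sub, map_mul, map_mul, sub_eq_iff_eq_add'] at this
    refine this.trans ?_
    congr 1
    split_ifs
    · exact map_one _
    · exact map_zero _

theorem adjoin_weyl :
    Algebra.adjoin K (Set.range (weylX K n) ∪ Set.range (weylY K n)) = ⊤ := by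
  rw [eq_top_iff]
  rintro w -
  obtain ⟨w, rfl⟩ := RingQuot.mkAlgHom_surjective K (WeylRel K n) w
  induction w using FreeAlgebra.induction with
  | grade0 c => rw [AlgHom.commutes]; exact Subalgebra.algebraMap_mem _ c
  | grade1 i =>
    rcases i with i | i
    · exact Algebra.subset_adjoin (Or.inl ⟨i, rfl⟩)
    · exact Algebra.subset_adjoin (Or.inr ⟨i, rfl⟩)
  | mul a b ha hb => rw [map_mul]; exact mul_mem ha hb
  | add a b ha hb => rw [map_add]; exact add_mem ha hb

variable {K n}

theorem IsWeylFamily.exists_algHom {B : Type*} [Ring B] [Algebra K B] {X Y : Fin n → B}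
    (h : IsWeylFamily X Y) :
    ∃ f : WeylAlgebra K n →ₐ[K] B, (∀ i, f (weylX K n i) = X i) ∧ ∀ i, f (weylY K n i) = Y i := by
  have rel : ∀ ⦃a b : FreeAlgebra K (Fin n ⊕ Fin n)⦄, WeylRel K n a b →
      FreeAlgebra.lift K (Sum.elim X Y) a = FreeAlgebra.lift K (Sum.elim X Y) b := by
    rintro _ _ (⟨i, j⟩ | ⟨i, j⟩ | ⟨i, j⟩)
    · simp [h.xx i j]
    · simp [h.yy i j]
    · simp only [map_sub, map_mul, FreeAlgebra.lift_ι_apply, Sum.elim_inl, Sum.elim_inr, h.yx i j]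
      split_ifs <;> simp
  refine ⟨RingQuot.liftAlgHom K ⟨FreeAlgebra.lift K (Sum.elim X Y), rel⟩, fun i => ?_, fun i => ?_⟩
  · rw [weylX, RingQuot.liftAlgHom_mkAlgHom_apply, FreeAlgebra.lift_ι_apply, Sum.elim_inl]
  · rw [weylY, RingQuot.liftAlgHom_mkAlgHom_apply, FreeAlgebra.lift_ι_apply, Sum.elim_inr]

/-- The Weyl algebra over a field of characteristic zero is simple. -/
theorem weylAlgebra_algHom_injective [CharZero K] {B : Type*} [Ring B] [Algebra K B]
    [Nontrivial B] (f : WeylAlgebra K n →ₐ[K] B) : Function.Injective f := by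
  rw [injective_iff_map_eq_zero]
  intro w hw
  have : w ∈ Algebra.adjoin K (Set.range (weylX K n) ∪ Set.range (weylY K n)) := by
    rw [adjoin_weyl]; trivial
  obtain ⟨N, hN⟩ := exists_mem_weylSpan_pow this
  exact (isWeylFamily_weyl K n).eq_zero_of_map_eq_zero f N hN hw

end WeylAlgebra

/-! ### Fractions of a subalgebra satisfying the Ore condition -/

/-- The left fractions of a subalgebra of a division ring that satisfies the left Ore condition
form a subalgebra. -/
def fractionSubalgebra {k D : Type*} [Field k] [DivisionRing D] [Algebra k D] (R : Subalgebra k D)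
    (ore : ∀ a ∈ R, ∀ b ∈ R, b ≠ 0 → ∃ c ∈ R, ∃ d ∈ R, d ≠ 0 ∧ d * a = c * b) :
    Subalgebra k D where
  carrier := {x | ∃ p ∈ R, p ≠ 0 ∧ p * x ∈ R}
  algebraMap_mem' c := ⟨1, one_mem R, one_ne_zero, by
    rw [one_mul]; exact R.algebraMap_mem c⟩
  add_mem' := by
    rintro x y ⟨p, hp, hp0, hpx⟩ ⟨q, hq, hq0, hqy⟩
    obtain ⟨c, hc, d, hd, hd0, e⟩ := ore p hp q hq hq0
    refine ⟨d * p, mul_mem hd hp, mul_ne_zero hd0 hp0, ?_⟩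
    rw [mul_add, mul_assoc]
    refine add_mem (mul_mem hd hpx) ?_
    rw [e, mul_assoc]
    exact mul_mem hc hqy
  mul_mem' := by
    rintro x y ⟨p, hp, hp0, hpx⟩ ⟨q, hq, hq0, hqy⟩
    -- Moves the denominator `q` to the left of the numerator `p x`: from `d (p x) = c q` follows `d
    -- p (x y) = c (q y)`.
    obtain ⟨c, hc, d, hd, hd0, e⟩ := ore (p * x) hpx q hq hq0
    refine ⟨d * p, mul_mem hd hp, mul_ne_zero hd0 hp0, ?_⟩
    rw [show d * p * (x * y) = d * (p * x) * y by simp only [mul_assoc], e, mul_assoc]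
    exact mul_mem hc hqy

theorem inv_mem_fractionSubalgebra {k D : Type*} [Field k] [DivisionRing D] [Algebra k D]
    {R : Subalgebra k D}
    {ore : ∀ a ∈ R, ∀ b ∈ R, b ≠ 0 → ∃ c ∈ R, ∃ d ∈ R, d ≠ 0 ∧ d * a = c * b} {x : D}
    (hx : x ∈ fractionSubalgebra R ore) (hx0 : x ≠ 0) : x⁻¹ ∈ fractionSubalgebra R ore := by
  obtain ⟨p, hp, hp0, hpx⟩ := hx
  refine ⟨p * x, hpx, mul_ne_zero hp0 hx0, ?_⟩
  rwa [mul_assoc, mul_inv_cancel₀ hx0, mul_one]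

/-! ### Transcendence degrees -/

theorem trdeg_fractionRing_of_algEquiv {k R : Type*} [Field k] [CommRing R] [IsDomain R]
    [Algebra k R] {s : ℕ} (e : MvPolynomial (Fin s) k ≃ₐ[k] R) :
    Algebra.trdeg k (FractionRing R) = (s : Cardinal) := by
  have h1 := e.isTranscendenceBasis (IsTranscendenceBasis.mvPolynomial (Fin s) k)
  have : Algebra.IsAlgebraic R (FractionRing R) :=
    IsLocalization.isAlgebraic _ (nonZeroDivisors R)
  have h2 := h1.algebraMap_comp (A := FractionRing R)
  simpa using h2.lift_cardinalMk_eq_trdeg.symm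

/-- If `s` algebraically independent elements are algebraic over `s` elements, then these are
algebraically independent as well. -/
theorem algebraicIndependent_of_isAlgebraic {k C : Type*} [Field k] [CommRing C] [IsDomain C]
    [Algebra k C] {s : ℕ} {x t : Fin s → C} (hx : AlgebraicIndependent k x)
    (h : ∀ i, IsAlgebraic (Algebra.adjoin k (Set.range t)) (x i)) : AlgebraicIndependent k t := by
  let M := AlgebraicIndependent.matroid k C
  have hsub : Set.range x ⊆ M.closure (Set.range t) := by
    rw [AlgebraicIndependent.matroid_closure_eq]
    rintro _ ⟨i, rfl⟩
    exact h i
  have hx' : M.Indep (Set.range x) := hx.to_subtype_range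
  -- In the matroid of algebraic independence, `s ≤ rank ≤ cardinality ≤ s` for the range of `t`, so
  -- equality holds throughout.
  have h1 : (s : ℕ∞) ≤ M.eRk (Set.range t) := by
    have e : (Set.range x).encard = s := by
      rw [← Set.image_univ, hx.injective.encard_image]; simp
    rw [← e, ← hx'.eRk_eq_encard, ← M.eRk_closure_eq (Set.range t)]
    exact M.eRk_mono hsub
  have h2 : (Set.range t).encard ≤ s := by
    rw [← Set.image_univ]
    exact (Set.encard_image_le _ _).trans (by simp)
  have h3 := M.eRk_le_encard (Set.range t)
  have hcard : (Set.range t).encard = s := le_antisymm h2 (h1.trans h3)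
  have hind : M.Indep (Set.range t) := by
    rw [Matroid.indep_iff_eRk_eq_encard_of_finite (Set.finite_range t)]
    exact le_antisymm h3 (hcard.le.trans h1)
  have hinj : Function.Injective t := by
    have : (Set.univ : Set (Fin s)).encard ≤ (t '' Set.univ).encard := by
      rw [Set.image_univ, hcard]; simp
    rw [← Set.injOn_univ]
    exact Set.finite_univ.injOn_of_encard_image_eq
      (le_antisymm (Set.encard_image_le _ _) this)
  exact (algebraicIndependent_subtype_range hinj).1 hind

/-! ### Generation of the skew field of fractions -/

section Generation

variable {AZ : Type v} [Ring AZ] (Z : ZCompatible.{u, v} AZ) {k : Type u} [Field k] [IsAlgClosed k]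

/-- A finite generating set of the filtration. -/
def ZCompatible.genSet : Finset AZ := Z.gens_fg.choose

theorem ZCompatible.span_genSet : Submodule.span ℤ (Z.genSet : Set AZ) = Z.gens :=
  Z.gens_fg.choose_spec

/-- A subring that contains the generators is everything. -/
theorem ZCompatible.subring_eq_top {S : Subring AZ} (hS : ∀ v ∈ Z.genSet, v ∈ S) : S = ⊤ := by
  let S' : Subalgebra ℤ AZ := subalgebraOfSubring S
  have h1 : 1 ⊔ Z.gens ≤ Subalgebra.toSubmodule S' := by
    refine sup_le (Submodule.one_le.2 S.one_mem) ?_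
    rw [← Z.span_genSet, Submodule.span_le]
    exact hS
  have h2 : ∀ i, filtr Z.gens i ≤ Subalgebra.toSubmodule S' := by
    intro i
    induction i with
    | zero => rw [filtr, pow_zero]; exact Submodule.one_le.2 S.one_mem
    | succ i ih =>
      rw [filtr, pow_succ, Submodule.mul_le]
      exact fun a ha b hb => S.mul_mem (ih ha) (h1 hb)
  rw [eq_top_iff]
  rintro a -
  obtain ⟨i, hi⟩ := Z.exists_mem_filtr a
  exact h2 i hi

/-- A division subalgebra of `Frac A_k` that contains the generators is everything. -/
theorem ZCompatible.mem_of_genSet {S : Subalgebra k (Z.Fraction k)}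
    (hS : ∀ v ∈ Z.genSet, Z.toFraction k v ∈ S)
    (hinv : ∀ x ∈ S, x ≠ 0 → x⁻¹ ∈ S) (d : Z.Fraction k) : d ∈ S := by
  have h1 : ∀ a, Z.toFraction k a ∈ S := by
    have := Z.subring_eq_top (S := S.toSubring.comap (Z.toFraction k)) hS
    intro a
    have ha : a ∈ S.toSubring.comap (Z.toFraction k) := by rw [this]; trivial
    exact ha
  have h2 : ∀ w, Z.incl k w ∈ S := by
    intro w
    induction w using TensorProduct.induction_on with
    | zero => rw [map_zero]; exact zero_mem S
    | tmul c a => rw [Z.incl_tmul]; exact mul_mem (S.algebraMap_mem c) (h1 a)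
    | add a b ha hb => rw [map_add]; exact add_mem ha hb
  obtain ⟨a, b, hb, e⟩ := Z.exists_fraction k d
  have hb0 : Z.incl k b ≠ 0 := (map_ne_zero_iff _ (Z.incl_injective k)).2 hb
  rw [show d = (Z.incl k b)⁻¹ * Z.incl k a by rw [← e, inv_mul_cancel_left₀ hb0]]
  exact mul_mem (hinv _ (h2 b) hb0) (h2 a)

/-- The centralizer of `z` is a division subalgebra. -/
theorem ZCompatible.mem_center_of_genSet {z : Z.Fraction k}
    (hz : ∀ v ∈ Z.genSet, z * Z.toFraction k v = Z.toFraction k v * z) :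
    z ∈ Subalgebra.center k (Z.Fraction k) := by
  rw [Subalgebra.mem_center_iff]
  intro d
  have := Z.mem_of_genSet (S := Subalgebra.centralizer k {z}) ?_ ?_ d
  · exact (Subalgebra.mem_centralizer_iff k).1 this z rfl |>.symm
  · intro v hv
    rw [Subalgebra.mem_centralizer_iff]
    rintro _ rfl
    exact hz v hv
  · intro x hx hx0
    rw [Subalgebra.mem_centralizer_iff] at hx ⊢
    rintro y rfl
    have : Commute y x := hx y rfl
    exact this.inv_right₀

theorem ZCompatible.toFraction_x_mem_center [CharZero k] (i : Fin Z.s) :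
    Z.toFraction k (Z.x i) ∈ Subalgebra.center k (Z.Fraction k) := by
  refine Z.mem_center_of_genSet fun v _ => ?_
  obtain ⟨e, he⟩ := Z.center_poly k
  have := (e (MvPolynomial.X i)).2
  rw [he, Subalgebra.mem_center_iff] at this
  rw [Z.toFraction_apply, Z.toFraction_apply, ← map_mul, ← map_mul, this]

variable (k) in
/-- The generator `x_i` of the centre of `A_k`, as a central fraction. -/
def ZCompatible.centralX [CharZero k] (i : Fin Z.s) : Subalgebra.center k (Z.Fraction k) :=
  ⟨Z.toFraction k (Z.x i), Z.toFraction_x_mem_center i⟩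

/-- Evaluation at the `x_i` is the isomorphism of `center_poly` followed by inclusions. -/
theorem ZCompatible.algebraicIndependent_centralX [CharZero k] :
    AlgebraicIndependent k (Z.centralX k) := by
  obtain ⟨e, he⟩ := Z.center_poly k
  have key : (Subalgebra.center k (Z.Fraction k)).val.comp (MvPolynomial.aeval (Z.centralX k)) =
      (Z.incl k).comp ((Subalgebra.center k (k ⊗[ℤ] AZ)).val.comp e.toAlgHom) := by
    ext i
    simp only [AlgHom.comp_apply, MvPolynomial.aeval_X]
    change Z.toFraction k (Z.x i) = Z.incl k (e (MvPolynomial.X i) : k ⊗[ℤ] AZ)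
    rw [he, Z.toFraction_apply]
  have inj : Function.Injective
      ((Z.incl k).comp ((Subalgebra.center k (k ⊗[ℤ] AZ)).val.comp e.toAlgHom)) :=
    (Z.incl_injective k).comp (Subtype.val_injective.comp e.injective)
  rw [← key] at inj
  exact Function.Injective.of_comp (f := (Subalgebra.center k (Z.Fraction k)).val) inj

/-- This forces `l = s` in the conjecture, whatever the field. -/
theorem ZCompatible.trdeg_center [CharZero k] :
    Algebra.trdeg k (FractionRing (Subalgebra.center k (k ⊗[ℤ] AZ))) = (Z.s : Cardinal) := by
  obtain ⟨e, -⟩ := Z.center_poly k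
  have := (Z.oreDomain k).isDomain
  exact trdeg_fractionRing_of_algEquiv e

/-! ### Weyl generators -/

variable (k) in
/-- Generators of Weyl type of `Frac A_k`: they satisfy the relations of `A_n(k[t_1, …, t_l])`, the
generators of `A_k` are left fractions in them, and the `x_i` are algebraic over the `T_j`. -/
structure ZCompatible.IsWeylGenerating {n l : ℕ} (X Y : Fin n → Z.Fraction k)
    (T : Fin l → Z.Fraction k) : Prop where
  weyl : IsWeylFamily X Y
  tt : ∀ i j, T i * T j = T j * T i
  tx : ∀ i j, T i * X j = X j * T i
  ty : ∀ i j, T i * Y j = Y j * T i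
  gen : ∀ v ∈ Z.genSet, ∃ p ∈ Algebra.adjoin k (Set.range X ∪ Set.range Y ∪ Set.range T),
    p ≠ 0 ∧ p * Z.toFraction k v ∈ Algebra.adjoin k (Set.range X ∪ Set.range Y ∪ Set.range T)
  alg : ∀ i : Fin Z.s, ∃ (N : ℕ) (P : ℕ → Z.Fraction k),
    (∀ m < N, P m ∈ Algebra.adjoin k (Set.range T)) ∧ (∃ m < N, P m ≠ 0) ∧
      ∑ m ∈ Finset.range N, P m * Z.toFraction k (Z.x i) ^ m = 0

theorem ZCompatible.spread_pow (x : Z.Fraction k) (m : ℕ) :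
    ∀ᶠ p in diagramFilter k, Z.spread (x ^ m) p = Z.spread x p ^ m := by
  induction m with
  | zero => simpa using Z.spread_one
  | succ m ih =>
    filter_upwards [ih, Z.spread_mul (x ^ m) x] with p h1 h2
    rw [pow_succ, h2, h1, pow_succ]

theorem ZCompatible.spread_sum {J : Type*} (s : Finset J) (f : J → Z.Fraction k) :
    ∀ᶠ p in diagramFilter k, Z.spread (∑ j ∈ s, f j) p = ∑ j ∈ s, Z.spread (f j) p := by
  classical
  induction s using Finset.induction_on with
  | empty => simpa using Z.spread_zero
  | insert a s ha ih =>
    filter_upwards [ih, Z.spread_add (f a) (∑ j ∈ s, f j)] with p h1 h2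
    rw [Finset.sum_insert ha, Finset.sum_insert ha, h2, h1]

theorem ZCompatible.spread_mul_comm {x y : Z.Fraction k} (h : x * y = y * x) :
    ∀ᶠ p in diagramFilter k, Z.spread x p * Z.spread y p = Z.spread y p * Z.spread x p := by
  filter_upwards [Z.spread_mul x y, Z.spread_mul y x] with p h1 h2
  rw [← h1, ← h2, h]

variable {Z} in
/-- Generators of Weyl type spread out to almost all points of the diagram of `k`. -/
theorem ZCompatible.IsWeylGenerating.spread {n l : ℕ} {X Y : Fin n → Z.Fraction k}
    {T : Fin l → Z.Fraction k} (h : Z.IsWeylGenerating k X Y T) :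
    ∀ᶠ p in diagramFilter k, Z.IsWeylGenerating p.carrier (fun i => Z.spread (X i) p)
      (fun i => Z.spread (Y i) p) (fun i => Z.spread (T i) p) := by
  have comm : ∀ {a b : ℕ} {f : Fin a → Z.Fraction k} {g : Fin b → Z.Fraction k},
      (∀ i j, f i * g j = g j * f i) → ∀ᶠ p in diagramFilter k, ∀ i j,
        Z.spread (f i) p * Z.spread (g j) p = Z.spread (g j) p * Z.spread (f i) p := by
    intro a b f g hfg
    simp only [Filter.eventually_all]
    exact fun i j => Z.spread_mul_comm (hfg i j)
  have yx : ∀ᶠ p in diagramFilter k, ∀ i j, Z.spread (Y i) p * Z.spread (X j) p =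
      Z.spread (X j) p * Z.spread (Y i) p + if i = j then 1 else 0 := by
    simp only [Filter.eventually_all]
    intro i j
    filter_upwards [Z.spread_mul (Y i) (X j), Z.spread_mul (X j) (Y i),
      Z.spread_add (X j * Y i) (if i = j then 1 else 0), Z.spread_one (k := k),
      Z.spread_zero (k := k)] with p h1 h2 h3 h4 h5
    rw [← h1, h.weyl.yx, h3, h2]
    congr 1
    split_ifs <;> assumption
  have gen : ∀ᶠ p in diagramFilter k, ∀ v ∈ Z.genSet,
      ∃ q ∈ Algebra.adjoin p.carrier (Set.range (fun i => Z.spread (X i) p) ∪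
        Set.range (fun i => Z.spread (Y i) p) ∪ Set.range fun i => Z.spread (T i) p),
      q ≠ 0 ∧ q * Z.toFraction p.carrier v ∈
        Algebra.adjoin p.carrier (Set.range (fun i => Z.spread (X i) p) ∪
        Set.range (fun i => Z.spread (Y i) p) ∪ Set.range fun i => Z.spread (T i) p) := by
    -- Finiteness of the generating set allows the quantifier over `v` to be exchanged with
    -- "eventually".
    rw [Filter.eventually_all_finset]
    intro v hv
    obtain ⟨q, hq, hq0, hqv⟩ := h.gen v hv
    filter_upwards [Z.spread_mem_adjoin hq, Z.spread_mem_adjoin hqv, Z.spread_ne_zero hq0,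
      Z.spread_mul q (Z.toFraction k v), Z.spread_toFraction (k := k) v] with p h1 h2 h3 h4 h5
    rw [Set.image_union, Set.image_union, ← Set.range_comp, ← Set.range_comp,
      ← Set.range_comp] at h1 h2
    rw [h4, h5] at h2
    exact ⟨_, h1, h3, h2⟩
  have alg : ∀ᶠ p in diagramFilter k, ∀ i : Fin Z.s, ∃ (N : ℕ) (P : ℕ → Z.Fraction p.carrier),
      (∀ m < N, P m ∈ Algebra.adjoin p.carrier (Set.range fun i => Z.spread (T i) p)) ∧
        (∃ m < N, P m ≠ 0) ∧
        ∑ m ∈ Finset.range N, P m * Z.toFraction p.carrier (Z.x i) ^ m = 0 := by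
    rw [Filter.eventually_all]
    intro i
    obtain ⟨N, P, hP, ⟨m, hm, hPm⟩, hsum⟩ := h.alg i
    have e1 : ∀ᶠ p in diagramFilter k, ∀ m ∈ Finset.range N, Z.spread (P m) p ∈
        Algebra.adjoin p.carrier (Set.range fun i => Z.spread (T i) p) := by
      rw [Filter.eventually_all_finset]
      intro m hm
      filter_upwards [Z.spread_mem_adjoin (hP m (Finset.mem_range.1 hm))] with p hp
      rwa [← Set.range_comp] at hp
    have e2 : ∀ᶠ p in diagramFilter k, ∀ m ∈ Finset.range N,
        Z.spread (P m * Z.toFraction k (Z.x i) ^ m) p =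
          Z.spread (P m) p * Z.toFraction p.carrier (Z.x i) ^ m := by
      rw [Filter.eventually_all_finset]
      intro m _
      filter_upwards [Z.spread_mul (P m) (Z.toFraction k (Z.x i) ^ m),
        Z.spread_pow (Z.toFraction k (Z.x i)) m, Z.spread_toFraction (k := k) (Z.x i)]
        with p h1 h2 h3
      rw [h1, h2, h3]
    filter_upwards [e1, e2, Z.spread_ne_zero hPm,
      Z.spread_sum (Finset.range N) fun m => P m * Z.toFraction k (Z.x i) ^ m,
      Z.spread_zero (k := k)] with p h1 h2 h3 h4 h5
    refine ⟨N, fun m => Z.spread (P m) p, fun m hm => h1 m (Finset.mem_range.2 hm),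
      ⟨m, hm, h3⟩, ?_⟩
    rw [hsum, h5] at h4
    exact (Finset.sum_congr rfl fun m hm => (h2 m hm).symm).trans h4.symm
  filter_upwards [comm h.weyl.xx, comm h.weyl.yy, yx, comm h.tt, comm h.tx, comm h.ty, gen, alg]
    with p h1 h2 h3 h4 h5 h6 h7 h8
  exact ⟨⟨h1, h2, h3⟩, h4, h5, h6, h7, h8⟩

end Generation

section Extract

variable {AZ : Type v} [Ring AZ] (Z : ZCompatible.{u, v} AZ) {k : Type u} [Field k] [IsAlgClosed k]

/-! ### From an isomorphism to Weyl generators -/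

theorem map_polynomial_mem_adjoin {k : Type*} [Field k] {n l : ℕ} {D : Type*} [Ring D]
    [Algebra k D] (g : WeylAlgebraOver k n l →ₐ[k] D) (τ : MvPolynomial (Fin l) k) :
    g (algebraMap (RatFunField k l) _ (algebraMap _ (RatFunField k l) τ)) ∈
        Algebra.adjoin k (Set.range (fun i => g (weylX (RatFunField k l) n i)) ∪
          Set.range (fun i => g (weylY (RatFunField k l) n i)) ∪
          Set.range fun j => g (algebraMap (RatFunField k l) _
            (algebraMap (MvPolynomial (Fin l) k) _ (MvPolynomial.X j)))) := by
  induction τ using MvPolynomial.induction_on with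
  | C c =>
    have e : algebraMap (RatFunField k l) (WeylAlgebraOver k n l)
        (algebraMap (MvPolynomial (Fin l) k) (RatFunField k l) (MvPolynomial.C c)) =
          algebraMap k _ c := by
      rw [IsScalarTower.algebraMap_apply k (RatFunField k l) (WeylAlgebraOver k n l),
        IsScalarTower.algebraMap_apply k (MvPolynomial (Fin l) k) (RatFunField k l)]
      rfl
    rw [e, AlgHom.commutes]
    exact Subalgebra.algebraMap_mem _ c
  | add p q hp hq => simp only [map_add]; exact add_mem hp hq
  | mul_X p j hp =>
    simp only [map_mul]
    exact mul_mem hp (Algebra.subset_adjoin (Or.inr ⟨j, rfl⟩))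

/-- Every element of `A_{n,l}(k)` becomes polynomial in the generators when it is multiplied with
a suitable nonzero polynomial in the central variables. -/
theorem exists_mul_mem_adjoin {k : Type*} [Field k] {n l : ℕ} {D : Type*} [Ring D] [Algebra k D]
    (g : WeylAlgebraOver k n l →ₐ[k] D) (w : WeylAlgebraOver k n l) :
    ∃ τ : MvPolynomial (Fin l) k, τ ≠ 0 ∧
      g (algebraMap (RatFunField k l) _ (algebraMap _ (RatFunField k l) τ) * w) ∈
        Algebra.adjoin k (Set.range (fun i => g (weylX (RatFunField k l) n i)) ∪
          Set.range (fun i => g (weylY (RatFunField k l) n i)) ∪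
          Set.range fun j => g (algebraMap (RatFunField k l) _
            (algebraMap (MvPolynomial (Fin l) k) _ (MvPolynomial.X j)))) := by
  have poly := map_polynomial_mem_adjoin g
  have hw : w ∈ Algebra.adjoin (RatFunField k l)
      (Set.range (weylX (RatFunField k l) n) ∪ Set.range (weylY (RatFunField k l) n)) := by
    rw [adjoin_weyl]; trivial
  induction hw using Algebra.adjoin_induction with
  | mem w hw =>
    refine ⟨1, one_ne_zero, ?_⟩
    rw [map_one, map_one, one_mul]
    rcases hw with ⟨i, rfl⟩ | ⟨i, rfl⟩
    · exact Algebra.subset_adjoin (Or.inl (Or.inl ⟨i, rfl⟩))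
    · exact Algebra.subset_adjoin (Or.inl (Or.inr ⟨i, rfl⟩))
  | algebraMap c =>
    obtain ⟨a, b, hb, rfl⟩ := IsFractionRing.div_surjective (A := MvPolynomial (Fin l) k) c
    have hb0 : b ≠ 0 := nonZeroDivisors.ne_zero hb
    refine ⟨b, hb0, ?_⟩
    rw [← map_mul, mul_div_cancel₀ _ (by
      rwa [Ne, FaithfulSMul.algebraMap_eq_zero_iff])]
    exact poly a
  | add a b _ _ ha hb =>
    obtain ⟨τ, hτ, ha⟩ := ha
    obtain ⟨υ, hυ, hb⟩ := hb
    refine ⟨τ * υ, mul_ne_zero hτ hυ, ?_⟩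
    have e : algebraMap (RatFunField k l) (WeylAlgebraOver k n l)
        (algebraMap _ (RatFunField k l) (τ * υ)) * (a + b) =
        algebraMap (RatFunField k l) _ (algebraMap _ (RatFunField k l) υ) *
          (algebraMap (RatFunField k l) _ (algebraMap _ (RatFunField k l) τ) * a) +
        algebraMap (RatFunField k l) _ (algebraMap _ (RatFunField k l) τ) *
          (algebraMap (RatFunField k l) _ (algebraMap _ (RatFunField k l) υ) * b) := by
      rw [mul_add, ← mul_assoc, ← mul_assoc, ← map_mul, ← map_mul, ← map_mul, ← map_mul,
        mul_comm υ τ]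
    rw [e, map_add]
    refine add_mem ?_ ?_
    · rw [map_mul]; exact mul_mem (poly υ) ha
    · rw [map_mul]; exact mul_mem (poly τ) hb
  | mul a b _ _ ha hb =>
    obtain ⟨τ, hτ, ha⟩ := ha
    obtain ⟨υ, hυ, hb⟩ := hb
    refine ⟨τ * υ, mul_ne_zero hτ hυ, ?_⟩
    -- Denominators from the field of rational functions are central, so they can be collected in
    -- front.
    have e : algebraMap (RatFunField k l) (WeylAlgebraOver k n l)
        (algebraMap _ (RatFunField k l) (τ * υ)) * (a * b) =
        (algebraMap (RatFunField k l) _ (algebraMap _ (RatFunField k l) τ) * a) *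
          (algebraMap (RatFunField k l) _ (algebraMap _ (RatFunField k l) υ) * b) := by
      rw [map_mul, map_mul, mul_assoc, mul_assoc, ← mul_assoc _ a b, ← mul_assoc a _ b,
        Algebra.commutes _ a]
    rw [e, map_mul]
    exact mul_mem ha hb

variable (k) in
theorem ZCompatible.trdeg_center_fraction [CharZero k] {l : ℕ}
    (h : Algebra.trdeg k (FractionRing (Subalgebra.center k (k ⊗[ℤ] AZ))) = (l : Cardinal)) :
    Algebra.trdeg k (Subalgebra.center k (Z.Fraction k)) = (l : Cardinal) := by
  obtain ⟨e⟩ : Nonempty (Subalgebra.center k (Z.Fraction k) ≃ₐ[k]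
    FractionRing (Subalgebra.center k (k ⊗[ℤ] AZ))) := Z.center_frac k
  exact e.trdeg_eq.trans h

/-- The generators are transported along the isomorphism. The images of the `t_j` are central and
independent, and their number is the transcendence degree of the centre of `Frac A_k`. Thus they
form a transcendence basis of it, over which the `x_i` are algebraic. -/
theorem ZCompatible.exists_isWeylGenerating [CharZero k] {n l : ℕ}
    (htr : Algebra.trdeg k (FractionRing (Subalgebra.center k (k ⊗[ℤ] AZ))) = (l : Cardinal))
    (h : IsoWeylField k n l (SkewFrac (k ⊗[ℤ] AZ) (Z.oreDomain k))) :
    ∃ (X Y : Fin n → Z.Fraction k) (T : Fin l → Z.Fraction k), Z.IsWeylGenerating k X Y T := by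
  obtain ⟨D, _, _, f, hf, ⟨e⟩⟩ := h
  let e' : D ≃ₐ[k] Z.Fraction k := e.symm.trans (Z.fractionEquiv k)
  let g : WeylAlgebraOver k n l →ₐ[k] Z.Fraction k := e'.toAlgHom.comp f
  have hg : Function.Injective g := e'.injective.comp hf.injective
  have hfrac : ∀ d : Z.Fraction k, ∃ a b : WeylAlgebraOver k n l, b ≠ 0 ∧ g b * d = g a := by
    intro d
    obtain ⟨a, b, hb, hd⟩ := hf.exists_fraction (e'.symm d)
    refine ⟨a, b, hb, ?_⟩
    have hfb : f b ≠ 0 := (map_ne_zero_iff f hf.injective).2 hb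
    have : f b * e'.symm d = f a := by
      rw [hd]; exact mul_inv_cancel_left₀ hfb (f a)
    calc g b * d = e' (f b) * e' (e'.symm d) := by rw [e'.apply_symm_apply]; rfl
      _ = e' (f b * e'.symm d) := (map_mul e' _ _).symm
      _ = g a := by rw [this]; rfl
  let ι : RatFunField k l →ₐ[k] Z.Fraction k :=
    g.comp (IsScalarTower.toAlgHom k (RatFunField k l) (WeylAlgebraOver k n l))
  have hι : ∀ c, ι c ∈ Subalgebra.center k (Z.Fraction k) := by
    intro c
    have hc : ∀ w, ι c * g w = g w * ι c := by
      intro w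
      change g (algebraMap _ _ c) * g w = g w * g (algebraMap _ _ c)
      rw [← map_mul, ← map_mul, Algebra.commutes]
    rw [Subalgebra.mem_center_iff]
    intro d
    obtain ⟨a, b, hb, hd⟩ := hfrac d
    have hb0 : g b ≠ 0 := (map_ne_zero_iff g hg).2 hb
    apply mul_left_cancel₀ hb0
    rw [← mul_assoc, hd, ← hc a, ← mul_assoc, ← hc b, mul_assoc, hd]
  let t : Fin l → RatFunField k l := fun j =>
    algebraMap (MvPolynomial (Fin l) k) _ (MvPolynomial.X j)
  let T' : Fin l → Subalgebra.center k (Z.Fraction k) := fun j => ⟨ι (t j), hι _⟩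
  have hT' : AlgebraicIndependent k T' := by
    have key : (Subalgebra.center k (Z.Fraction k)).val.comp (MvPolynomial.aeval T') =
        ι.comp (IsScalarTower.toAlgHom k (MvPolynomial (Fin l) k) (RatFunField k l)) := by
      ext i
      simp only [AlgHom.comp_apply, MvPolynomial.aeval_X]
      rfl
    have inj : Function.Injective
        (ι.comp (IsScalarTower.toAlgHom k (MvPolynomial (Fin l) k) (RatFunField k l))) :=
      ι.toRingHom.injective.comp (IsFractionRing.injective (MvPolynomial (Fin l) k) _)
    rw [← key] at inj
    exact Function.Injective.of_comp (f := (Subalgebra.center k (Z.Fraction k)).val) inj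
  have hbasis : IsTranscendenceBasis k T' := by
    refine hT'.isTranscendenceBasis_of_lift_trdeg_le_of_finite ?_
    rw [Z.trdeg_center_fraction k htr]
    simp
  have halg := hbasis.isAlgebraic
  refine ⟨fun i => g (weylX _ n i), fun i => g (weylY _ n i), fun j => ι (t j),
    ⟨?_, ?_, ?_⟩, ?_, ?_, ?_, ?_, ?_⟩
  · intro i j
    rw [← map_mul, (isWeylFamily_weyl _ n).xx, map_mul]
  · intro i j
    rw [← map_mul, (isWeylFamily_weyl _ n).yy, map_mul]
  · intro i j
    rw [← map_mul, (isWeylFamily_weyl _ n).yx, map_add, map_mul]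
    congr 1
    split_ifs <;> simp
  · intro i j
    exact (Subalgebra.mem_center_iff.1 (hι (t i)) _).symm
  · intro i j
    exact (Subalgebra.mem_center_iff.1 (hι (t i)) _).symm
  · intro i j
    exact (Subalgebra.mem_center_iff.1 (hι (t i)) _).symm
  · intro v _
    obtain ⟨a, b, hb, hv⟩ := hfrac (Z.toFraction k v)
    obtain ⟨τ, hτ, ha⟩ := exists_mul_mem_adjoin g a
    obtain ⟨υ, hυ, hb'⟩ := exists_mul_mem_adjoin g b
    let c : MvPolynomial (Fin l) k → WeylAlgebraOver k n l := fun σ =>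
      algebraMap (RatFunField k l) _ (algebraMap _ (RatFunField k l) σ)
    have hc : ∀ σ, σ ≠ 0 → g (c σ) ≠ 0 := by
      intro σ hσ
      change ι (algebraMap _ _ σ) ≠ 0
      rw [Ne, map_eq_zero, FaithfulSMul.algebraMap_eq_zero_iff]
      exact hσ
    have hcomm : g (c τ) * g (c υ) = g (c υ) * g (c τ) := by
      exact (map_mul g _ _).symm.trans ((congrArg g (Algebra.commutes _ _)).trans (map_mul g _ _))
    -- `v = b⁻¹ a`, with `τ` and `υ` clearing the coefficients of `a` and `b`; both sides are
    -- multiplied by the central element `τ υ`.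
    refine ⟨g (c τ) * g (c υ * b), mul_mem (map_polynomial_mem_adjoin g τ) hb', ?_, ?_⟩
    · rw [map_mul]
      exact mul_ne_zero (hc τ hτ) (mul_ne_zero (hc υ hυ) ((map_ne_zero_iff g hg).2 hb))
    · have e : g (c τ) * g (c υ * b) * Z.toFraction k v = g (c υ) * g (c τ * a) := by
        rw [map_mul, map_mul, ← hv, ← mul_assoc, ← mul_assoc, ← mul_assoc, hcomm]
      rw [e]
      exact mul_mem (map_polynomial_mem_adjoin g υ) ha
  · intro i
    obtain ⟨p, hp0, hp⟩ := halg.isAlgebraic (Z.centralX k i)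
    refine ⟨p.natDegree + 1, fun m => ((p.coeff m : Subalgebra.center k (Z.Fraction k)) :
      Z.Fraction k), ?_, ⟨p.natDegree, Nat.lt_succ_self _, ?_⟩, ?_⟩
    · intro m _
      have e := AlgHom.map_adjoin (Subalgebra.center k (Z.Fraction k)).val (Set.range T')
      rw [← Set.range_comp] at e
      change _ ∈ Algebra.adjoin k (Set.range ((Subalgebra.center k (Z.Fraction k)).val ∘ T'))
      rw [← e]
      exact ⟨_, (p.coeff m).2, rfl⟩
    · intro h0
      refine hp0 (Polynomial.leadingCoeff_eq_zero.1 ?_)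
      exact Subtype.ext (Subtype.ext h0)
    · rw [Polynomial.aeval_eq_sum_range] at hp
      have := congrArg (Subalgebra.center k (Z.Fraction k)).val hp
      rw [map_sum, map_zero] at this
      rw [← this]
      rfl

end Extract

section Reconstruct

variable {AZ : Type v} [Ring AZ] (Z : ZCompatible.{u, v} AZ) {k : Type u} [Field k] [IsAlgClosed k]

/-! ### From Weyl generators to an isomorphism -/

include Z in
-- `A_ℤ` is a countable union of finitely generated abelian groups. This settles the universe
-- question in `small_fraction`.
theorem ZCompatible.countable : Countable AZ := by
  have h : ∀ i, Countable (filtr Z.gens i) := by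
    intro i
    have hfg : (filtr Z.gens i).FG :=
      Submodule.FG.pow (Submodule.FG.sup ⟨{1}, by rw [Finset.coe_singleton, Submodule.one_eq_span]⟩
        Z.gens_fg) i
    have : Module.Finite ℤ (filtr Z.gens i) := Module.Finite.iff_fg.2 hfg
    obtain ⟨m, f, hf⟩ := Module.Finite.exists_fin' ℤ (filtr Z.gens i)
    exact hf.countable
  have hU : (Set.univ : Set AZ) = ⋃ i, (filtr Z.gens i : Set AZ) := by
    refine (Set.eq_univ_of_forall fun a => ?_).symm
    obtain ⟨i, hi⟩ := Z.exists_mem_filtr a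
    exact Set.mem_iUnion.2 ⟨i, hi⟩
  rw [← Set.countable_univ_iff, hU]
  exact Set.countable_iUnion fun i => Set.countable_coe_iff.1 (h i)

/-- `IsoWeylField` asks for a skew field in the universe of `k`. Fractions are coded by pairs of
tensors, and tensors by finite lists over `k × A_ℤ`, so `Frac A_k` has a copy there. -/
theorem ZCompatible.small_fraction : Small.{u} (Z.Fraction k) := by
  have := Z.countable
  have h0 : Small.{u} AZ := inferInstance
  have h1 : Small.{u} (k ⊗[ℤ] AZ) := by
    have hs : Function.Surjective (fun w : List (k × AZ) =>
        (w.map fun p => p.1 ⊗ₜ[ℤ] p.2).sum) := by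
      intro w
      induction w using TensorProduct.induction_on with
      | zero => exact ⟨[], rfl⟩
      | tmul c a => exact ⟨[(c, a)], by simp⟩
      | add a b ha hb =>
        obtain ⟨a, rfl⟩ := ha
        obtain ⟨b, rfl⟩ := hb
        exact ⟨a ++ b, by simp⟩
    exact small_of_surjective hs
  have hs : Function.Surjective (fun p : (k ⊗[ℤ] AZ) × (k ⊗[ℤ] AZ) =>
      (Z.incl k p.1)⁻¹ * Z.incl k p.2) := by
    intro d
    obtain ⟨a, b, hb, e⟩ := Z.exists_fraction k d
    have hb0 : Z.incl k b ≠ 0 := (map_ne_zero_iff _ (Z.incl_injective k)).2 hb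
    refine ⟨(b, a), ?_⟩
    change (Z.incl k b)⁻¹ * Z.incl k a = d
    rw [← e, inv_mul_cancel_left₀ hb0]
  exact small_of_surjective hs

omit [IsAlgClosed k] in
/-- A nonzero central element of a division ring is invertible in the centre. -/
theorem isUnit_center {D : Type*} [DivisionRing D] [Algebra k D] {c : Subalgebra.center k D}
    (hc : c ≠ 0) : IsUnit c := by
  have hc0 : (c : D) ≠ 0 := fun h => hc (Subtype.ext h)
  have hinv : (c : D)⁻¹ ∈ Subalgebra.center k D := by
    rw [Subalgebra.mem_center_iff]
    intro d
    have : Commute d (c : D) := Subalgebra.mem_center_iff.1 c.2 d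
    exact this.inv_right₀
  exact ⟨⟨c, ⟨_, hinv⟩, Subtype.ext (mul_inv_cancel₀ hc0), Subtype.ext (inv_mul_cancel₀ hc0)⟩, rfl⟩

theorem adjoin_union_le_restrictScalars {k K D : Type*} [Field k] [Field K] [Ring D] [Algebra k K]
    [Algebra K D] [Algebra k D] [IsScalarTower k K D] {S T : Set D}
    (hT : ∀ x ∈ T, ∃ c : K, x = algebraMap K D c) :
    Algebra.adjoin k (S ∪ T) ≤ (Algebra.adjoin K S).restrictScalars k := by
  rw [Algebra.adjoin_le_iff]
  rintro x (hx | hx)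
  · exact Algebra.subset_adjoin (R := K) hx
  · obtain ⟨c, rfl⟩ := hT x hx
    exact Subalgebra.algebraMap_mem (Algebra.adjoin K S) c

/-- The left fractions of the image of the Weyl algebra in a division ring form a division
subalgebra. -/
theorem IsWeylFamily.exists_fractions {k K D : Type*} [Field k] [Field K] [CharZero K]
    [DivisionRing D] [Algebra k K] [Algebra K D] [Algebra k D] [IsScalarTower k K D] {n : ℕ}
    {X Y : Fin n → D} (h : IsWeylFamily X Y) :
    ∃ (f : WeylAlgebra K n →ₐ[K] D) (F : Subalgebra k D), Function.Injective f ∧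
      (∀ d ∈ F, ∃ a b, b ≠ 0 ∧ f b * d = f a) ∧
      (∀ p ∈ Algebra.adjoin K (Set.range X ∪ Set.range Y), ∀ d, p ≠ 0 →
        p * d ∈ Algebra.adjoin K (Set.range X ∪ Set.range Y) → d ∈ F) ∧
      ∀ d ∈ F, d ≠ 0 → d⁻¹ ∈ F := by
  obtain ⟨f, hfX, hfY⟩ := h.exists_algHom (K := K)
  have hR : Algebra.adjoin K (Set.range X ∪ Set.range Y) ≤ f.range := by
    rw [Algebra.adjoin_le_iff]
    rintro _ (⟨i, rfl⟩ | ⟨i, rfl⟩)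
    · exact ⟨_, hfX i⟩
    · exact ⟨_, hfY i⟩
  refine ⟨f, fractionSubalgebra
    ((Algebra.adjoin K (Set.range X ∪ Set.range Y)).restrictScalars k)
    fun a ha b hb hb0 => h.exists_left_ore ha hb hb0, weylAlgebra_algHom_injective f, ?_,
    fun p hp d hp0 hpd => ⟨p, hp, hp0, hpd⟩, fun d hd hd0 => inv_mem_fractionSubalgebra hd hd0⟩
  rintro d ⟨p, hp, hp0, hpd⟩
  obtain ⟨b, rfl⟩ := hR hp
  obtain ⟨a, ha⟩ := hR hpd
  exact ⟨a, b, fun hb => hp0 (by rw [hb, map_zero]), ha.symm⟩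

variable {Z}

namespace ZCompatible.IsWeylGenerating

variable {n l : ℕ} {X Y : Fin n → Z.Fraction k} {T : Fin l → Z.Fraction k}

/-- `T j` commutes with `p` and with `p v`, hence with `v` after cancelling `p`. -/
theorem mem_center (h : Z.IsWeylGenerating k X Y T) (j : Fin l) :
    T j ∈ Subalgebra.center k (Z.Fraction k) := by
  have hS : Algebra.adjoin k (Set.range X ∪ Set.range Y ∪ Set.range T) ≤
      Subalgebra.centralizer k {T j} := by
    rw [Algebra.adjoin_le_iff]
    rintro _ ((⟨i, rfl⟩ | ⟨i, rfl⟩) | ⟨i, rfl⟩) <;>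
      rw [SetLike.mem_coe, Subalgebra.mem_centralizer_iff] <;> rintro _ rfl
    · exact h.tx j i
    · exact h.ty j i
    · exact h.tt j i
  refine Z.mem_center_of_genSet fun v hv => ?_
  obtain ⟨p, hp, hp0, hpv⟩ := h.gen v hv
  have h1 : T j * p = p * T j := (Subalgebra.mem_centralizer_iff k).1 (hS hp) _ rfl
  have h2 := (Subalgebra.mem_centralizer_iff k).1 (hS hpv) _ rfl
  apply mul_left_cancel₀ hp0
  rw [← mul_assoc, ← h1, mul_assoc, h2, mul_assoc]

/-- Independence of the `T_j` is an infinite set of inequations, which no finite piece of the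
diagram expresses directly. It follows instead from finitely many equations: the `s` independent
elements `x_i` are algebraic over as many elements `T_j`. -/
theorem algebraicIndependent [CharZero k] (h : Z.IsWeylGenerating k X Y T) (hs : Z.s = l) :
    AlgebraicIndependent k fun j => (⟨T j, h.mem_center j⟩ : Subalgebra.center k (Z.Fraction k)) := by
  subst hs
  refine algebraicIndependent_of_isAlgebraic Z.algebraicIndependent_centralX fun i => ?_
  set T' : Fin Z.s → Subalgebra.center k (Z.Fraction k) := fun j => ⟨T j, h.mem_center j⟩
  obtain ⟨N, P, hP, ⟨m, hm, hPm⟩, hsum⟩ := h.alg i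
  have e := AlgHom.map_adjoin (Subalgebra.center k (Z.Fraction k)).val (Set.range T')
  rw [← Set.range_comp] at e
  have hP' : ∀ m, ∃ q : Algebra.adjoin k (Set.range T'),
      m < N → ((q : Subalgebra.center k (Z.Fraction k)) : Z.Fraction k) = P m := by
    intro m
    by_cases hm : m < N
    · have := hP m hm
      change P m ∈ Algebra.adjoin k
        (Set.range ((Subalgebra.center k (Z.Fraction k)).val ∘ T')) at this
      rw [← e] at this
      obtain ⟨q, hq, hqP⟩ := this
      exact ⟨⟨q, hq⟩, fun _ => hqP⟩
    · exact ⟨0, fun h => absurd h hm⟩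
  choose Q hQ using hP'
  refine ⟨∑ m ∈ Finset.range N, Polynomial.monomial m (Q m), ?_, ?_⟩
  · intro h0
    have := congrArg (fun p => Polynomial.coeff p m) h0
    simp only [Polynomial.finsetSum_coeff, Polynomial.coeff_monomial, Finset.sum_ite_eq',
      Finset.mem_range, hm, if_true, Polynomial.coeff_zero] at this
    apply hPm
    rw [← hQ m hm, this]
    rfl
  · rw [map_sum]
    apply Subtype.ext
    rw [← Subalgebra.coe_val, map_sum]
    refine Eq.trans (Finset.sum_congr rfl fun m hm => ?_) hsum
    rw [Polynomial.aeval_monomial, map_mul, map_pow, ← hQ m (Finset.mem_range.1 hm)]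
    rfl

/-- If the `T_j` come from the field of rational functions, then `Frac A_k` is a Weyl field. -/
theorem isoWeylField_of_algebra [CharZero k] (h : Z.IsWeylGenerating k X Y T)
    [Algebra (RatFunField k l) (Z.Fraction k)]
    [IsScalarTower k (RatFunField k l) (Z.Fraction k)]
    {t : Fin l → RatFunField k l} (hT : ∀ j, T j = algebraMap _ (Z.Fraction k) (t j)) :
    IsoWeylField k n l (SkewFrac (k ⊗[ℤ] AZ) (Z.oreDomain k)) := by
  have : CharZero (RatFunField k l) :=
    charZero_of_injective_algebraMap (algebraMap k (RatFunField k l)).injective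
  obtain ⟨f, F, hinj, hfrac, hmem, hinv⟩ :=
    h.weyl.exists_fractions (k := k) (K := RatFunField k l)
  have hSR : Algebra.adjoin k (Set.range X ∪ Set.range Y ∪ Set.range T) ≤
      (Algebra.adjoin (RatFunField k l) (Set.range X ∪ Set.range Y)).restrictScalars k := by
    refine adjoin_union_le_restrictScalars ?_
    rintro _ ⟨j, rfl⟩
    exact ⟨t j, hT j⟩
  have hF : ∀ d, d ∈ F := by
    refine Z.mem_of_genSet (S := F) (fun v hv => ?_) hinv
    obtain ⟨p, hp, hp0, hpv⟩ := h.gen v hv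
    exact hmem p (hSR hp) _ hp0 (hSR hpv)
  have hsmall : Small.{u} (Z.Fraction k) := Z.small_fraction
  let σ : Shrink.{u} (Z.Fraction k) ≃ₐ[k] Z.Fraction k := Shrink.algEquiv k (Z.Fraction k)
  refine ⟨Shrink.{u} (Z.Fraction k), inferInstance, inferInstance,
    σ.symm.toAlgHom.comp (f.restrictScalars k), ⟨?_, ?_⟩, ⟨(Z.fractionEquiv k).trans σ.symm⟩⟩
  · exact σ.symm.injective.comp hinj
  · intro d
    obtain ⟨a, b, hb, hd⟩ := hfrac _ (hF (σ d))
    refine ⟨a, b, hb, ?_⟩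
    change d = (σ.symm (f b))⁻¹ * σ.symm (f a)
    have hb0 : σ.symm (f b) ≠ 0 :=
      (map_ne_zero_iff _ σ.symm.injective).2 ((map_ne_zero_iff f hinj).2 hb)
    rw [← hd, map_mul, σ.symm_apply_apply, inv_mul_cancel_left₀ hb0]

/-- Weyl generators identify `Frac A_k` with a Weyl field. -/
theorem isoWeylField [CharZero k] (h : Z.IsWeylGenerating k X Y T) (hs : Z.s = l) :
    IsoWeylField k n l (SkewFrac (k ⊗[ℤ] AZ) (Z.oreDomain k)) := by
  set T' : Fin l → Subalgebra.center k (Z.Fraction k) := fun j => ⟨T j, h.mem_center j⟩ with hT'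
  have hind : AlgebraicIndependent k T' := h.algebraicIndependent hs
  have hunit : ∀ y : nonZeroDivisors (MvPolynomial (Fin l) k),
      IsUnit (MvPolynomial.aeval T' (y : MvPolynomial (Fin l) k)) := fun y =>
    isUnit_center ((map_ne_zero_iff _ hind).2 (nonZeroDivisors.coe_ne_zero y))
  -- Independence makes nonzero polynomials in the `T_j` invertible in the centre, so evaluation at
  -- the `T_j` extends to rational functions.
  let φ : RatFunField k l →ₐ[k] Subalgebra.center k (Z.Fraction k) :=
    IsLocalization.liftAlgHom (M := nonZeroDivisors (MvPolynomial (Fin l) k)) hunit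
  have hφ : ∀ j, φ (algebraMap (MvPolynomial (Fin l) k) _ (MvPolynomial.X j)) = T' j := by
    intro j
    change IsLocalization.lift hunit _ = _
    rw [IsLocalization.lift_eq]
    exact MvPolynomial.aeval_X T' j
  let _ : Algebra (RatFunField k l) (Z.Fraction k) :=
    RingHom.toAlgebra' ((Subalgebra.center k (Z.Fraction k)).val.comp φ).toRingHom
      fun c d => (Subalgebra.mem_center_iff.1 (φ c).2 d).symm
  have hmap : ∀ c, algebraMap (RatFunField k l) (Z.Fraction k) c = (φ c : Z.Fraction k) :=
    fun c => rfl
  have : IsScalarTower k (RatFunField k l) (Z.Fraction k) :=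
    IsScalarTower.of_algebraMap_eq fun c => by rw [hmap, AlgHom.commutes]; rfl
  have hT : ∀ j, T j = algebraMap (RatFunField k l) (Z.Fraction k)
      (algebraMap (MvPolynomial (Fin l) k) _ (MvPolynomial.X j)) := fun j => by
    rw [hmap, hφ]
  exact h.isoWeylField_of_algebra hT
end ZCompatible.IsWeylGenerating

/-! ### Transfer of the conjecture to almost all points. -/

variable (Z)

/-- `gens` is finitely generated and lies in the free first layer, so it is torsion-free and hence
free over `ℤ`. -/
theorem ZCompatible.free_gens : Module.Finite ℤ Z.gens ∧ Module.Free ℤ Z.gens := by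
  have hfin : Module.Finite ℤ Z.gens := Module.Finite.iff_fg.2 Z.gens_fg
  have hle : Z.gens ≤ filtr Z.gens 1 := by rw [filtr, pow_one]; exact le_sup_right
  have := Z.filtr_free 1
  have htf : Module.IsTorsionFree ℤ Z.gens :=
    (Submodule.inclusion_injective hle).moduleIsTorsionFree (Submodule.inclusion hle) (by simp)
  exact ⟨hfin, inferInstance⟩

/-- The right-hand side does not depend on `k`, which carries the equation `Tdeg = 2n + l` from one
field to another. -/
theorem ZCompatible.tdeg_eq_finrank :
    Tdeg k (SkewFrac (k ⊗[ℤ] AZ) (Z.oreDomain k)) = (Module.finrank ℤ Z.gens : EReal) := by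
  have := Z.free_gens.2
  rw [Z.tdeg_eq, Module.finrank_baseChange]

/-- If the conjecture holds over `k`, it holds at almost all points of the diagram of `k`. -/
theorem ZCompatible.eventually_gelfandKirillovHolds [CharZero k]
    (h : GelfandKirillovHolds k (k ⊗[ℤ] AZ) (Z.oreDomain k)) :
    ∀ᶠ p in diagramFilter k,
      GelfandKirillovHolds p.carrier (p.carrier ⊗[ℤ] AZ) (Z.oreDomain p.carrier) := by
  obtain ⟨n, l, htdeg, htr, hiso⟩ := h
  have hs : Z.s = l := by
    have := Z.trdeg_center (k := k)
    rw [htr] at this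
    exact_mod_cast this.symm
  obtain ⟨X, Y, T, hXYT⟩ := Z.exists_isWeylGenerating htr hiso
  filter_upwards [hXYT.spread] with p hp
  refine ⟨n, l, ?_, ?_, hp.isoWeylField hs⟩
  · rw [← htdeg, Z.tdeg_eq_finrank, Z.tdeg_eq_finrank]
  · rw [Z.trdeg_center, hs]

end Reconstruct

/-! ### The existential sentence of a finite piece of a diagram -/

section Logic

open FirstOrder FirstOrder.Language

/-- The interpretation of the symbols `0, 1, +, *` in a ring. -/
@[reducible]
def arithStructure (R : Type*) [Ring R] : arithLang.Structure R where
  funMap := fun f x => match f with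
    | .zero => 0
    | .one => 1
    | .add => x 0 + x 1
    | .mul => x 0 * x 1
  RelMap := fun r _ => Empty.elim r

/-- The term `0`. -/
def zeroTerm {α : Type*} : arithLang.Term α := Constants.term (ArithFunc.zero : arithLang.Constants)

/-- The term `1`. -/
def oneTerm {α : Type*} : arithLang.Term α := Constants.term (ArithFunc.one : arithLang.Constants)

/-- The sum of two terms. -/
def addTerm {α : Type*} (s t : arithLang.Term α) : arithLang.Term α :=
  Functions.apply₂ (ArithFunc.add : arithLang.Functions 2) s t

/-- The product of two terms. -/
def mulTerm {α : Type*} (s t : arithLang.Term α) : arithLang.Term α :=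
  Functions.apply₂ (ArithFunc.mul : arithLang.Functions 2) s t

/-- The quantifier-free formula of a basic formula, with the parameter `a` replaced by the variable
`ν a`. -/
def Literal.toFormula {k : Type u} [Field k] {N : ℕ} (ν : k → Fin N) :
    Literal k → arithLang.BoundedFormula Empty N
  | .one => Term.bdEqual (Term.var (Sum.inr (ν 1))) oneTerm
  | .add a b => Term.bdEqual (Term.var (Sum.inr (ν (a + b))))
      (addTerm (Term.var (Sum.inr (ν a))) (Term.var (Sum.inr (ν b))))
  | .mul a b => Term.bdEqual (Term.var (Sum.inr (ν (a * b))))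
      (mulTerm (Term.var (Sum.inr (ν a))) (Term.var (Sum.inr (ν b))))
  | .ne a => (Term.bdEqual (Term.var (Sum.inr (ν a))) zeroTerm).not

theorem Literal.isQF_toFormula {k : Type u} [Field k] {N : ℕ} (ν : k → Fin N) (L : Literal k) :
    (L.toFormula ν).IsQF := by
  cases L with
  | one => exact (BoundedFormula.IsAtomic.equal _ _).isQF
  | add a b => exact (BoundedFormula.IsAtomic.equal _ _).isQF
  | mul a b => exact (BoundedFormula.IsAtomic.equal _ _).isQF
  | ne a => exact (BoundedFormula.IsAtomic.equal _ _).isQF.not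

theorem Literal.realize_toFormula {k : Type u} [Field k] {N : ℕ} (ν : k → Fin N) (L : Literal k)
    {R : Type*} [Field R] (v : Empty → R) (xs : Fin N → R) :
    letI := arithStructure R
    (L.toFormula ν).Realize v xs ↔ L.Holds fun a => xs (ν a) := by
  let _ := arithStructure R
  cases L with
  | one =>
    simp only [Literal.toFormula, oneTerm, BoundedFormula.realize_bdEqual, Term.realize_var,
      Sum.elim_inr]
    rfl
  | add a b =>
    simp only [Literal.toFormula, addTerm, BoundedFormula.realize_bdEqual, Term.realize_var,
      Sum.elim_inr]
    rfl
  | mul a b =>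
    simp only [Literal.toFormula, mulTerm, BoundedFormula.realize_bdEqual, Term.realize_var,
      Sum.elim_inr]
    rfl
  | ne a =>
    simp only [Literal.toFormula, zeroTerm, BoundedFormula.realize_bdEqual, Term.realize_var,
      BoundedFormula.realize_not, Sum.elim_inr]
    rfl

/-- The parameters of a basic formula. -/
def Literal.params {k : Type u} [Field k] : Literal k → Set k
  | .one => {1}
  | .add a b => {a, b, a + b}
  | .mul a b => {a, b, a * b}
  | .ne a => {a}

theorem Literal.finite_params {k : Type u} [Field k] (L : Literal k) : L.params.Finite := by
  cases L <;> simp [Literal.params]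

theorem Literal.holds_congr {k : Type u} [Field k] {R : Type*} [Field R] {c c' : k → R}
    {L : Literal k} (h : ∀ a ∈ L.params, c a = c' a) : L.Holds c ↔ L.Holds c' := by
  cases L <;> simp [Literal.params, Literal.Holds] at h ⊢ <;> simp [h]

/-- A finite piece of the diagram of `k` is expressed by an existential sentence. -/
theorem exists_sentence {k : Type u} [Field k] {S : Set (Literal k)} (hS : S.Finite) :
    ∃ (N : ℕ) (ψ : arithLang.BoundedFormula Empty N), ψ.IsQF ∧
      ∀ (R : Type u) [Field R], letI := arithStructure R
        (R ⊨ ψ.exs ↔ ∃ c : k → R, ∀ L ∈ S, L.Holds c) := by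
  classical
  -- One variable for each parameter that occurs; `0` is added to provide a default value for `ν`.
  let P : Set k := insert 0 (⋃ L ∈ S, L.params)
  have hP : P.Finite := (hS.biUnion fun L _ => L.finite_params).insert 0
  have : Fintype P := hP.fintype
  let e : P ≃ Fin (Fintype.card P) := Fintype.equivFin P
  let ν : k → Fin (Fintype.card P) := fun a =>
    if h : a ∈ P then e ⟨a, h⟩ else e ⟨0, Set.mem_insert _ _⟩
  have hν : ∀ (a : k) (h : a ∈ P), ν a = e ⟨a, h⟩ := fun a h => dif_pos h
  let l : List (arithLang.BoundedFormula Empty (Fintype.card P)) :=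
    hS.toFinset.toList.map (Literal.toFormula ν)
  have hmem : ∀ φ, φ ∈ l ↔ ∃ L ∈ S, L.toFormula ν = φ := by simp [l]
  refine ⟨_, l.foldr (· ⊓ ·) ⊤, ?_, ?_⟩
  · have : ∀ l' : List (arithLang.BoundedFormula Empty (Fintype.card P)),
        (∀ φ ∈ l', φ.IsQF) → (l'.foldr (· ⊓ ·) ⊤).IsQF := by
      intro l' hl'
      induction l' with
      | nil => exact BoundedFormula.IsQF.top
      | cons φ l' ih =>
        exact (hl' φ (by simp)).inf (ih fun φ hφ => hl' φ (by simp [hφ]))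
    refine this l fun φ hφ => ?_
    obtain ⟨L, -, rfl⟩ := (hmem φ).1 hφ
    exact L.isQF_toFormula ν
  · intro R _
    let _ := arithStructure R
    rw [Sentence.Realize, BoundedFormula.realize_exs]
    simp only [BoundedFormula.realize_foldr_inf]
    constructor
    · rintro ⟨xs, hxs⟩
      refine ⟨fun a => xs (ν a), fun L hL => ?_⟩
      exact (L.realize_toFormula ν _ xs).1 (hxs _ ((hmem _).2 ⟨L, hL, rfl⟩))
    · rintro ⟨c, hc⟩
      refine ⟨fun i => c (e.symm i), fun φ hφ => ?_⟩
      obtain ⟨L, hL, rfl⟩ := (hmem φ).1 hφ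
      rw [L.realize_toFormula ν]
      refine (Literal.holds_congr fun a ha => ?_).1 (hc L hL)
      have haP : a ∈ P := Set.mem_insert_of_mem _ (Set.mem_biUnion hL ha)
      rw [hν a haP, Equiv.symm_apply_apply]

/-- Provability of a sentence from `ACF 0` is its truth in one algebraically closed field of
characteristic zero. -/
theorem models_ACF_iff (φ : arithLang.Sentence) (R : Type u) [Field R] [IsAlgClosed R]
    [CharZero R] :
    letI := arithStructure R
    (Theory.ACF 0 ⊨ᵇ arithToRing.onSentence φ) ↔ R ⊨ φ := by
  let _ := arithStructure R
  let _ := FirstOrder.Ring.compatibleRingOfRing R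
  have : arithToRing.IsExpansionOn R :=
    { map_onFunction := by
        intro n f x
        cases f
        · exact FirstOrder.Ring.CompatibleRing.funMap_zero x
        · exact FirstOrder.Ring.CompatibleRing.funMap_one x
        · exact FirstOrder.Ring.CompatibleRing.funMap_add x
        · exact FirstOrder.Ring.CompatibleRing.funMap_mul x
      map_onRelation := by
        intro n r x
        exact Empty.elim r }
  rw [← (FirstOrder.Field.ACF_isComplete (Or.inr rfl)).realize_sentence_iff _ R,
    LHom.realize_onSentence]

end Logic

end ZCompat

end

/-! ### The main theorem. -/

theorem mainTheorem2 (AZ : Type v) [Ring AZ] (K : ZCompat.ZCompatible.{u, v} AZ) :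
    ∃ φ : ZCompat.arithLang.Sentence,
      (∃ (N : ℕ) (ψ : ZCompat.arithLang.BoundedFormula Empty N), ψ.IsQF ∧ φ = ψ.exs) ∧
      List.TFAE [
        ∃ (k : Type u) (_ : Field k) (_ : IsAlgClosed k) (_ : CharZero k),
          ZCompat.GelfandKirillovHolds k (k ⊗[ℤ] AZ) (K.oreDomain k),
        ∀ (k : Type u) [Field k] [IsAlgClosed k] [CharZero k],
          ZCompat.GelfandKirillovHolds k (k ⊗[ℤ] AZ) (K.oreDomain k),
        FirstOrder.Language.Theory.ACF 0 ⊨ᵇ ZCompat.arithToRing.onSentence φ] := by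
  by_cases h1 : ∃ (k : Type u) (_ : Field k) (_ : IsAlgClosed k) (_ : CharZero k),
      ZCompat.GelfandKirillovHolds k (k ⊗[ℤ] AZ) (K.oreDomain k)
  · obtain ⟨k, _, _, _, hk⟩ := h1
    obtain ⟨S, hS, hSk, hSP⟩ :=
      ZCompat.exists_literals_of_eventually (K.eventually_gelfandKirillovHolds hk)
    obtain ⟨N, ψ, hψ, hreal⟩ := ZCompat.exists_sentence hS
    refine ⟨ψ.exs, ⟨N, ψ, hψ, rfl⟩, ?_⟩
    -- The identity of `k` realizes the sentence, and completeness does the rest.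
    tfae_have 1 → 3 := fun _ => (ZCompat.models_ACF_iff _ k).2 ((hreal k).2 ⟨id, hSk⟩)
    tfae_have 3 → 2 := by
      intro h k' _ _ _
      obtain ⟨c, hc⟩ := (hreal k').1 ((ZCompat.models_ACF_iff _ k').1 h)
      exact hSP ⟨k', c⟩ hc
    tfae_have 2 → 1 := fun h => ⟨k, _, ‹_›, ‹_›, h k⟩
    tfae_finish
  -- A model of `ACF 0` in the required universe: it refutes `⊥` and makes the second statement
  -- imply the first.
  · let k : Type u := AlgebraicClosure (ULift.{u} ℚ)
    have : CharZero k := charZero_of_injective_ringHom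
      ((algebraMap (ULift.{u} ℚ) k).comp (ULift.ringEquiv.{0, u} (R := ℚ)).symm.toRingHom).injective
    refine ⟨⊥, ⟨0, ⊥, FirstOrder.Language.BoundedFormula.IsQF.falsum, rfl⟩, ?_⟩
    tfae_have 1 → 3 := fun h => absurd h h1
    tfae_have 3 → 2 := fun h => absurd ((ZCompat.models_ACF_iff _ k).1 h) (by
      let _ := ZCompat.arithStructure k
      exact FirstOrder.Language.BoundedFormula.realize_bot.1)
    tfae_have 2 → 1 := fun h => ⟨k, inferInstance, inferInstance, this, h k⟩
    tfae_finish
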